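/- Call a real random variable $X$ *symmetric with log-concave tails* if $X$ and $-X$ have the same law and the function $T_X(t)=\mathbb P(|X|\ge t)$ is log-concave on $[0,\infty)$, i.e. $T_X(ws+(1-w)t)\ge T_X(s)^wT_X(t)^{1-w}$ for all $s,t\ge 0$, $w\in(0,1)$. Let $\mathcal G^-$ be the set of laws of symmetric random variables $X$ with $$T_X(t)=e^{-\alpha(t-\beta)_+},\quad t\ge 0,\qquad\text{for some }\alpha\in[0,+\infty],\ \beta\in[0,+\infty),$$ where $\alpha=+\infty$ means $T_X=\mathbf 1_{[0,\beta]}$, and let $\mathcal G^+$ be the set of laws of symmetric random variables $X$ with $$T_X(t)=e^{-\alpha t}\mathbf 1_{[0,\beta]}(t),\quad t\ge 0,\qquad\text{for some }\alpha\in[0,+\infty),\ \beta\in[0,+\infty],$$ where $\beta=+\infty$ means $T_X(t)=e^{-\alpha t}$. **Theorem.** Fix $p>4$, $n\ge 1$ and let $a_1,\dots,a_n,b_1,\dots,b_n>0$ be feasible, that is, for every $j$ there is a symmetric random variable $X$ with log-concave tails such that $\mathbb E X^2=a_j^2$ and $\mathbb E|X|^p=b_j^p$. Then for every $j$ there are a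 unique law in $\mathcal G^-$ and a unique law in $\mathcal G^+$ with second moment $a_j^2$ and $p$-th absolute moment $b_j^p$. Let $\mathbf X_1^-,\dots,\mathbf X_n^-$ be independent with these laws in $\mathcal G^-$, and $\mathbf X_1^+,\dots,\mathbf X_n^+$ independent with these laws in $\mathcal G^+$. Then $$\inf\ \mathbb E\Big|\sum_{j=1}^n X_j\Big|^p=\mathbb E\Big|\sum_{j=1}^n\mathbf X_j^-\Big|^p\qquad\text{and}\qquad \sup\ \mathbb E\Big|\sum_{j=1}^n X_j\Big|^p=\mathbb E\Big|\sum_{j=1}^n\mathbf X_j^+\Big|^p,$$ where the infimum and the supremum are taken over all sequences $(X_1,\dots,X_n)$ of independent symmetric random variables with log-concave tails such that $\mathbb E X_j^2=a_j^2$ and $\mathbb E|X_j|^p=b_j^p$ for all $j$; both are attained. -/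

import Mathlib

open MeasureTheory ProbabilityTheory

universe u

noncomputable section

namespace LogTail

/-- The tail function `t ↦ P(|X| ≥ t)` of a real random variable `X` with law `μ`. -/
def tail (μ : Measure ℝ) (t : ℝ) : ℝ := μ.real {x : ℝ | t ≤ |x|}

/-- `μ` is the law of a symmetric real random variable: a probability measure on `ℝ`
invariant under `x ↦ -x`. -/
structure IsSymmetricLaw (μ : Measure ℝ) : Prop where
  isProbabilityMeasure : IsProbabilityMeasure μ
  map_neg : μ.map (fun x : ℝ => -x) = μ

/-- The tail function of `μ` is log-concave on `[0, ∞)`. -/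
def HasLogConcaveTail (μ : Measure ℝ) : Prop :=
  ∀ s t : ℝ, 0 ≤ s → 0 ≤ t → ∀ w : ℝ, 0 < w → w < 1 →
    tail μ s ^ w * tail μ t ^ (1 - w) ≤ tail μ (w * s + (1 - w) * t)

/-- Second moment `a ^ 2` and `p`-th absolute moment `b ^ p`. It is used for `a, b > 0` only, so
that both integrands are integrable (otherwise the integrals would be `0`). -/
structure HasMoments (p a b : ℝ) (μ : Measure ℝ) : Prop where
  second : ∫ x, x ^ 2 ∂μ = a ^ 2
  pth : ∫ x, |x| ^ p ∂μ = b ^ p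

/-- The class of symmetric laws with tail `exp (-α (t - β)₊)`, where `α ∈ [0, ∞]` and
`β ∈ [0, ∞)`. For `α = ∞` the tail is the indicator function of `[0, β]`, so the law is that of a
random sign times `β`. -/
def GMinus : Set (Measure ℝ) :=
  {μ | IsSymmetricLaw μ ∧
    ((∃ α β : ℝ, 0 ≤ α ∧ 0 ≤ β ∧ ∀ t : ℝ, 0 ≤ t →
        tail μ t = Real.exp (-(α * max (t - β) 0))) ∨
      (∃ β : ℝ, 0 ≤ β ∧ ∀ t : ℝ, 0 ≤ t →
        tail μ t = (Set.Icc 0 β).indicator (fun _ => (1 : ℝ)) t))}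

/-- The class of symmetric laws with tail `exp (-α t) 1_{[0, β]}(t)`, where `α ∈ [0, ∞)` and
`β ∈ [0, ∞]`. For `β = ∞` the tail is `exp (-α t)`, so the law is two-sided exponential. -/
def GPlus : Set (Measure ℝ) :=
  {μ | IsSymmetricLaw μ ∧
    ((∃ α β : ℝ, 0 ≤ α ∧ 0 ≤ β ∧ ∀ t : ℝ, 0 ≤ t →
        tail μ t = (Set.Icc 0 β).indicator (fun s => Real.exp (-(α * s))) t) ∨
      (∃ α : ℝ, 0 ≤ α ∧ ∀ t : ℝ, 0 ≤ t → tail μ t = Real.exp (-(α * t))))}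

/-- `(a, b)` is feasible: some symmetric law with log-concave tail has second moment `a ^ 2` and
`p`-th absolute moment `b ^ p`. -/
def Feasible (p a b : ℝ) : Prop :=
  ∃ μ : Measure ℝ, IsSymmetricLaw μ ∧ HasLogConcaveTail μ ∧ HasMoments p a b μ

/-- `X 0, …, X (n - 1)` are independent symmetric random variables with log-concave tails and the
prescribed moments. -/
structure Admissible {n : ℕ} (p : ℝ) (a b : Fin n → ℝ) {Ω : Type*} [MeasurableSpace Ω]
    (P : Measure Ω) (X : Fin n → Ω → ℝ) : Prop where
  measurable : ∀ j, Measurable (X j)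
  indep : iIndepFun X P
  symmetric : ∀ j, IsSymmetricLaw (P.map (X j))
  logConcaveTail : ∀ j, HasLogConcaveTail (P.map (X j))
  moments : ∀ j, HasMoments p (a j) (b j) (P.map (X j))

/-- The set of values `E |∑ X_j| ^ p` over all admissible sequences on all probability spaces. -/
def sumMoments {n : ℕ} (p : ℝ) (a b : Fin n → ℝ) : Set ℝ :=
  {v | ∃ (Ω : Type u) (_ : MeasurableSpace Ω) (P : Measure Ω) (X : Fin n → Ω → ℝ),
    IsProbabilityMeasure P ∧ Admissible p a b P X ∧ v = ∫ ω, |∑ j, X j ω| ^ p ∂P}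

end LogTail

end

/-! Independence reduces the theorem to one variable: if replacing the law of `X` changes `E |X + y|
^ p` in a fixed direction for every real `y`, the laws can be exchanged one at a time, the remaining
sum playing the role of `y` (`lintegral_pi_mono`).

By symmetry one may take `y ≥ 0` and integrate the even function `f x = (|x + y| ^ p + |x - y| ^ p)
/ 2`. The layer-cake formula turns `E f(X)` into `f 0` plus the integral of `f'` against the tail,
and turns the moment constraints into integrals of the tail against `t` and `t ^ (p - 1)`. So the
difference `D` of two competing tails is orthogonal to `t` and `t ^ (p - 1)`, and the sign of `∫ f'
D` is wanted.

Two facts decide it. For `p > 4`, `f' t = t * H (t ^ (p - 2))` with `H` concave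
(`concaveOn_shiftWeight`). And a log-concave tail exceeds a `GMinus` tail only on an interval, while
a `GPlus` tail exceeds a log-concave one only on an interval. If `c + d u` is the chord of `H` over
that interval, then `H - (c + d u)` has the sign of `D`; the terms `c t + d t ^ (p - 1)` integrate
to zero against `D`, so `∫ f' D ≥ 0` (`double_crossing`). With fewer than two sign changes the same
argument, with a constant in place of the chord, forces `D = 0` (`single_crossing`).

Single crossing also gives uniqueness, since two tails of the same extremal class cross at most
once. Existence is the intermediate value theorem along a family joining the random sign to the
two-sided exponential law, which have the least and the greatest `p`-th moment for a given second
moment. -/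

namespace LogTail

open Set

/-! ### Concavity of the shift weight -/

/-- The weight `t ↦ p (|t + y| ^ (p - 2) (t + y) + |t - y| ^ (p - 2) (t - y)) / 2`, i.e. the
derivative of `x ↦ (|x + y| ^ p + |x - y| ^ p) / 2`. -/
noncomputable def shiftWeight (p y t : ℝ) : ℝ :=
  p / 2 * (|t + y| ^ (p - 2) * (t + y) + |t - y| ^ (p - 2) * (t - y))

/-- Termwise comparison of the odd power series of `log (1 + x) - log (1 - x)`, using `r ≤ r ^ (2 k
+ 1)`. -/
lemma mul_log_sub_log_le {r x : ℝ} (hr : 1 ≤ r) (hx : 0 ≤ x) (hrx : r * x < 1) :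
    r * (Real.log (1 + x) - Real.log (1 - x)) ≤ Real.log (1 + r * x) - Real.log (1 - r * x) := by
  have hxr : x ≤ r * x := le_mul_of_one_le_left hx hr
  have h1 : |x| < 1 := by rw [abs_of_nonneg hx]; linarith
  have h2 : |r * x| < 1 := by rw [abs_of_nonneg (by linarith)]; exact hrx
  refine hasSum_le (fun k => ?_) ((Real.hasSum_log_sub_log_of_abs_lt_one h1).mul_left r)
    (Real.hasSum_log_sub_log_of_abs_lt_one h2)
  have h3 : r ≤ r ^ (2 * k + 1) := le_self_pow₀ hr (by omega)
  have h4 : 0 ≤ (2 : ℝ) * (1 / (2 * k + 1)) := by positivity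
  rw [mul_pow]
  calc r * (2 * (1 / (2 * k + 1)) * x ^ (2 * k + 1))
      = (2 * (1 / (2 * k + 1)) * x ^ (2 * k + 1)) * r := by ring
    _ ≤ (2 * (1 / (2 * k + 1)) * x ^ (2 * k + 1)) * r ^ (2 * k + 1) := by gcongr
    _ = _ := by ring

lemma one_add_rpow_mul_le {r x : ℝ} (hr : 1 ≤ r) (hx : 0 ≤ x) (hx1 : x < 1) :
    (1 + x) ^ r * (1 - r * x) ≤ (1 - x) ^ r * (1 + r * x) := by
  have hr0 : 0 < r := by linarith
  rcases le_or_gt 1 (r * x) with h | h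
  · have h1 : (1 + x) ^ r * (1 - r * x) ≤ 0 :=
      mul_nonpos_of_nonneg_of_nonpos (by positivity) (by linarith)
    have h2 : 0 ≤ (1 - x) ^ r * (1 + r * x) :=
      mul_nonneg (Real.rpow_nonneg (by linarith) _) (by positivity)
    linarith
  · have key := mul_log_sub_log_le hr hx h
    have a1 : 0 < 1 + x := by linarith
    have a2 : 0 < 1 - x := by linarith
    have a3 : 0 < 1 - r * x := by linarith
    have a4 : 0 < 1 + r * x := by positivity
    have b1 := Real.rpow_pos_of_pos a1 r
    have b2 := Real.rpow_pos_of_pos a2 r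
    rw [← Real.log_le_log_iff (by positivity) (by positivity), Real.log_mul b1.ne' a3.ne',
      Real.log_mul b2.ne' a4.ne', Real.log_rpow a1, Real.log_rpow a2]
    linarith

/-- The inequality behind the concavity of the shift weight. -/
lemma abs_rpow_add_abs_rpow_nonpos {r t y : ℝ} (hr : 1 ≤ r) (ht : 0 < t) (hy : 0 < y) :
    |t + y| ^ (r - 1) * (t + y) * (y - r * t) + |t - y| ^ (r - 1) * (t - y) * (y + r * t) ≤ 0 := by
  have hA : 0 < t + y := by positivity
  have hrt : t ≤ r * t := le_mul_of_one_le_left ht.le hr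
  have eA : |t + y| ^ (r - 1) * (t + y) = (t + y) ^ r := by
    rw [abs_of_pos hA, ← Real.rpow_add_one hA.ne', sub_add_cancel]
  rw [eA]
  rcases lt_trichotomy t y with h | h | h
  -- For `t < y`, division by `y ^ (r + 1)` reduces the claim to `one_add_rpow_mul_le` at `x = t /
  -- y`.
  · have hB : 0 < y - t := by linarith
    have eB : |t - y| ^ (r - 1) * (t - y) = -(y - t) ^ r := by
      rw [abs_sub_comm, abs_of_pos hB, ← neg_sub y t, mul_neg, ← Real.rpow_add_one hB.ne',
        sub_add_cancel]
    rw [eB]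
    have key := one_add_rpow_mul_le hr (div_nonneg ht.le hy.le) ((div_lt_one hy).2 h)
    have e1 : t + y = y * (1 + t / y) := by field_simp; ring
    have e2 : y - t = y * (1 - t / y) := by field_simp
    have e3 : y - r * t = y * (1 - r * (t / y)) := by field_simp
    have e4 : y + r * t = y * (1 + r * (t / y)) := by field_simp
    have hty : t / y < 1 := (div_lt_one hy).2 h
    have hty0 : 0 ≤ t / y := by positivity
    rw [e3, e4, e1, e2, Real.mul_rpow hy.le (by linarith), Real.mul_rpow hy.le (by linarith)]
    have := mul_le_mul_of_nonneg_left key (by positivity : 0 ≤ y ^ r * y)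
    nlinarith [this]
  · subst h
    have : (t + t) ^ r * (t - r * t) ≤ 0 :=
      mul_nonpos_of_nonneg_of_nonpos (by positivity) (by linarith)
    simpa using this
  · have hB : 0 < t - y := by linarith
    have eB : |t - y| ^ (r - 1) * (t - y) = (t - y) ^ r := by
      rw [abs_of_pos hB, ← Real.rpow_add_one hB.ne', sub_add_cancel]
    rw [eB]
    have h1 : (t - y) ^ (r - 1) ≤ (t + y) ^ (r - 1) :=
      Real.rpow_le_rpow hB.le (by linarith) (by linarith)
    -- The two sides differ by `2 (r - 1) t y`.
    have h2 : (t - y) * (y + r * t) ≤ (t + y) * (r * t - y) := by nlinarith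
    have h3 : 0 ≤ (t - y) * (y + r * t) := by positivity
    have h4 := mul_le_mul h1 h2 h3 (Real.rpow_nonneg hA.le _)
    have f1 : (t - y) ^ r = (t - y) ^ (r - 1) * (t - y) := by
      rw [← Real.rpow_add_one hB.ne', sub_add_cancel]
    have f2 : (t + y) ^ r = (t + y) ^ (r - 1) * (t + y) := by
      rw [← Real.rpow_add_one hA.ne', sub_add_cancel]
    rw [f1, f2]
    nlinarith [h4]

lemma abs_rpow_eq_mul_mul_self {q : ℝ} (hq : q ≠ 0) (x : ℝ) :
    |x| ^ q = |x| ^ (q - 2) * (x * x) := by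
  rcases eq_or_ne x 0 with rfl | hx
  · simp [Real.zero_rpow hq]
  · rw [← abs_mul_abs_self x, ← mul_assoc, ← Real.rpow_add_one (abs_ne_zero.2 hx),
      ← Real.rpow_add_one (abs_ne_zero.2 hx)]
    ring_nf

lemma hasDerivAt_abs_rpow_mul {q : ℝ} (hq : 1 < q) (x : ℝ) :
    HasDerivAt (fun x : ℝ => |x| ^ q * x) ((q + 1) * |x| ^ q) x := by
  refine ((hasDerivAt_abs_rpow x hq).mul (hasDerivAt_id x)).congr_deriv ?_
  rw [abs_rpow_eq_mul_mul_self (by linarith : q ≠ 0) x]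
  simp only [id]
  ring

lemma hasDerivAt_shiftWeight {p : ℝ} (hp : 3 < p) (y t : ℝ) :
    HasDerivAt (shiftWeight p y)
      (p / 2 * (p - 1) * (|t + y| ^ (p - 2) + |t - y| ^ (p - 2))) t := by
  have h1 := (hasDerivAt_abs_rpow_mul (by linarith : 1 < p - 2) (t + y)).comp_add_const t y
  have h2 := (hasDerivAt_abs_rpow_mul (by linarith : 1 < p - 2) (t - y)).comp_sub_const t y
  refine ((h1.add h2).const_mul (p / 2)).congr_deriv ?_
  ring

/-- Up to a power of `t`, the derivative of `t ↦ shiftWeight p y t / t`. -/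
noncomputable def shiftSlope (p y t : ℝ) : ℝ :=
  (t * (p / 2 * (p - 1) * (|t + y| ^ (p - 2) + |t - y| ^ (p - 2))) - shiftWeight p y t) *
    t ^ (-(p - 1))

/-- The derivative is a nonnegative multiple of `y` times the expression in
`abs_rpow_add_abs_rpow_nonpos` with `r = p - 3`. The condition `1 ≤ r` is where `p > 4` enters. -/
lemma antitoneOn_shiftSlope {p y : ℝ} (hp : 4 < p) (hy : 0 ≤ y) :
    AntitoneOn (shiftSlope p y) (Ioi 0) := by
  have hd : ∀ t ∈ Ioi (0 : ℝ), ∃ c, HasDerivAt (shiftSlope p y) c t ∧ c ≤ 0 := by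
    intro t ht
    have ht0 : 0 < t := ht
    have h1 := (hasDerivAt_abs_rpow (t + y) (by linarith : 1 < p - 2)).comp_add_const t y
    have h2 := (hasDerivAt_abs_rpow (t - y) (by linarith : 1 < p - 2)).comp_sub_const t y
    have h3 := (((hasDerivAt_id t).mul ((h1.add h2).const_mul (p / 2 * (p - 1)))).sub
      (hasDerivAt_shiftWeight (by linarith : 3 < p) y t)).mul
      (Real.hasDerivAt_rpow_const (x := t) (p := -(p - 1)) (Or.inl ht0.ne'))
    refine ⟨_, h3, ?_⟩
    have key : y * (|t + y| ^ (p - 3 - 1) * (t + y) * (y - (p - 3) * t) +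
        |t - y| ^ (p - 3 - 1) * (t - y) * (y + (p - 3) * t)) ≤ 0 := by
      rcases hy.eq_or_lt with rfl | hy
      · simp
      · exact mul_nonpos_of_nonneg_of_nonpos hy.le
          (abs_rpow_add_abs_rpow_nonpos (by linarith) ht0 hy)
    have e0 : t ^ (-(p - 1)) = t ^ (-(p - 1) - 1) * t := by
      rw [← Real.rpow_add_one ht0.ne', sub_add_cancel]
    -- Everything is expressed through `|t ± y| ^ (p - 4)`, so that the identity becomes polynomial.
    have e1 := abs_rpow_eq_mul_mul_self (by linarith : p - 2 ≠ 0) (t + y)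
    have e2 := abs_rpow_eq_mul_mul_self (by linarith : p - 2 ≠ 0) (t - y)
    have e3 : p - 3 - 1 = p - 2 - 2 := by ring
    rw [e3] at key
    have hpos : 0 ≤ p / 2 * (p - 1) * t ^ (-(p - 1) - 1) :=
      mul_nonneg (by nlinarith) (Real.rpow_nonneg ht0.le _)
    have := mul_nonpos_of_nonneg_of_nonpos hpos key
    refine le_of_eq_of_le ?_ this
    simp only [shiftWeight, id, Pi.add_apply, Pi.sub_apply, Pi.mul_apply]
    rw [e0, e1, e2]
    ring
  refine antitoneOn_of_deriv_nonpos (convex_Ioi 0) (fun t ht => ?_) (fun t ht => ?_)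
    (fun t ht => ?_)
  · obtain ⟨c, hc, -⟩ := hd t ht
    exact hc.continuousAt.continuousWithinAt
  · obtain ⟨c, hc, -⟩ := hd t (interior_subset ht)
    exact hc.differentiableAt.differentiableWithinAt
  · obtain ⟨c, hc, hc0⟩ := hd t (interior_subset ht)
    rwa [hc.deriv]

/-- `t ↦ shiftWeight p y t / t` is a concave function of `t ^ (p - 2)`. -/
lemma concaveOn_shiftWeight {p y : ℝ} (hp : 4 < p) (hy : 0 ≤ y) :
    ConcaveOn ℝ (Ioi 0)
      (fun u : ℝ => shiftWeight p y (u ^ (p - 2)⁻¹) / u ^ (p - 2)⁻¹) := by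
  have hp2 : 0 < p - 2 := by linarith
  have hd : ∀ u ∈ Ioi (0 : ℝ), HasDerivAt
      (fun u : ℝ => shiftWeight p y (u ^ (p - 2)⁻¹) / u ^ (p - 2)⁻¹)
      ((p - 2)⁻¹ * shiftSlope p y (u ^ (p - 2)⁻¹)) u := by
    intro u hu
    have hu0 : 0 < u := hu
    have ht := Real.rpow_pos_of_pos hu0 (p - 2)⁻¹
    have h1 := Real.hasDerivAt_rpow_const (x := u) (p := (p - 2)⁻¹) (Or.inl hu0.ne')
    have h2 := ((hasDerivAt_shiftWeight (by linarith : 3 < p) y (u ^ (p - 2)⁻¹)).div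
      (hasDerivAt_id _) ht.ne').comp u h1
    refine h2.congr_deriv ?_
    -- With `t = u ^ (p - 2)⁻¹`, the chain-rule factor is `t ^ (3 - p)` up to a constant; its part
    -- `t ^ 2` cancels the denominator of the quotient rule.
    have e : u ^ ((p - 2)⁻¹ - 1) = (u ^ (p - 2)⁻¹) ^ (-(p - 1)) * (u ^ (p - 2)⁻¹) ^ 2 := by
      rw [← Real.rpow_natCast, ← Real.rpow_add ht, ← Real.rpow_mul hu0.le]
      congr 1
      push_cast
      field_simp
      ring
    rw [e, shiftSlope]
    simp only [id]
    field_simp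
  refine AntitoneOn.concaveOn_of_deriv (convex_Ioi 0)
    (fun u hu => (hd u hu).continuousAt.continuousWithinAt)
    (fun u hu => (hd u (interior_subset hu)).differentiableAt.differentiableWithinAt) ?_
  rw [interior_Ioi]
  intro u hu v hv huv
  rw [(hd u hu).deriv, (hd v hv).deriv]
  refine mul_le_mul_of_nonneg_left ?_ (inv_nonneg.2 hp2.le)
  exact antitoneOn_shiftSlope hp hy (Real.rpow_pos_of_pos hu _) (Real.rpow_pos_of_pos hv _)
    (Real.rpow_le_rpow (le_of_lt hu) huv (inv_nonneg.2 hp2.le))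

/-- The map `s ↦ |s| ^ (p - 2) s` is odd and increasing, and `|t - y| ≤ t + y`. The layer-cake
formula needs this sign. -/
lemma shiftWeight_nonneg {p y t : ℝ} (hp : 2 ≤ p) (hy : 0 ≤ y) (ht : 0 ≤ t) :
    0 ≤ shiftWeight p y t := by
  have h1 : |t - y| ≤ t + y := by rw [abs_le]; constructor <;> linarith
  have h2 : |t - y| ^ (p - 2) ≤ |t + y| ^ (p - 2) := by
    rw [abs_of_nonneg (by linarith : 0 ≤ t + y)]
    exact Real.rpow_le_rpow (abs_nonneg _) h1 (by linarith)
  have h3 : |t - y| ^ (p - 2) * |t - y| ≤ |t + y| ^ (p - 2) * (t + y) :=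
    mul_le_mul h2 h1 (abs_nonneg _) (by positivity)
  have h4 : -(|t - y| ^ (p - 2) * |t - y|) ≤ |t - y| ^ (p - 2) * (t - y) := by
    rw [← mul_neg]
    exact mul_le_mul_of_nonneg_left (neg_abs_le _) (by positivity)
  unfold shiftWeight
  exact mul_nonneg (by linarith) (by linarith)

lemma continuous_shiftWeight {p : ℝ} (hp : 2 ≤ p) (y : ℝ) : Continuous (shiftWeight p y) := by
  have h : 0 ≤ p - 2 := by linarith
  unfold shiftWeight
  refine continuous_const.mul (.add (.mul ?_ (by fun_prop)) (.mul ?_ (by fun_prop)))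
  · exact (by fun_prop : Continuous fun t : ℝ => |t + y|).rpow_const fun _ => Or.inr h
  · exact (by fun_prop : Continuous fun t : ℝ => |t - y|).rpow_const fun _ => Or.inr h

lemma hasDerivAt_symm_shift {p : ℝ} (hp : 1 < p) (y t : ℝ) :
    HasDerivAt (fun x : ℝ => (|x + y| ^ p + |x - y| ^ p) / 2) (shiftWeight p y t) t := by
  have h1 := (hasDerivAt_abs_rpow (t + y) hp).comp_add_const t y
  have h2 := (hasDerivAt_abs_rpow (t - y) hp).comp_sub_const t y
  refine ((h1.add h2).div_const 2).congr_deriv ?_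
  rw [shiftWeight]
  ring

/-! ### Sign changes -/

lemma ae_eq_zero_of_mul {w D : ℝ → ℝ} {t₀ : ℝ} (hw : ∀ t, 0 < t → t ≠ t₀ → w t ≠ 0)
    (h : (fun t => w t * D t) =ᵐ[volume.restrict (Ioi 0)] 0) :
    D =ᵐ[volume.restrict (Ioi 0)] 0 := by
  have hne : ∀ᵐ t ∂(volume.restrict (Ioi (0 : ℝ))), t ≠ t₀ :=
    ae_restrict_of_ae (by simp [ae_iff])
  filter_upwards [h, hne, ae_restrict_mem measurableSet_Ioi] with t h1 h2 h3
  exact (mul_eq_zero.1 h1).resolve_left (hw t h3 h2)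

/-- If `D` changes sign at most once, from nonpositive to nonnegative, and is orthogonal to `t`,
then its integral against `t ^ (p - 1)` is nonnegative, and vanishes only if `D` does. -/
lemma single_crossing {p : ℝ} (hp : 2 < p) {D : ℝ → ℝ}
    (hD : ∀ t u, 0 < t → t < u → 0 < D t → 0 ≤ D u)
    (i1 : IntegrableOn (fun t => t * D t) (Ioi 0))
    (i2 : IntegrableOn (fun t => t ^ (p - 1) * D t) (Ioi 0))
    (z1 : ∫ t in Ioi 0, t * D t = 0) :
    0 ≤ ∫ t in Ioi 0, t ^ (p - 1) * D t ∧
      (∫ t in Ioi 0, t ^ (p - 1) * D t = 0 → D =ᵐ[volume.restrict (Ioi 0)] 0) := by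
  by_cases hP : ∃ t, 0 < t ∧ 0 < D t
  · obtain ⟨t₁, ht₁⟩ := hP
    set P : Set ℝ := {t | 0 < t ∧ 0 < D t} with hPdef
    have hne : P.Nonempty := ⟨t₁, ht₁⟩
    have hbdd : BddBelow P := ⟨0, fun t ht => ht.1.le⟩
    -- The crossing point: `D ≤ 0` before it and `D ≥ 0` after it.
    set t₀ := sInf P
    have ht₀ : 0 ≤ t₀ := le_csInf hne fun t ht => ht.1.le
    have hlow : ∀ t, 0 < t → t < t₀ → D t ≤ 0 := by
      intro t ht htt
      by_contra! hc
      exact absurd (csInf_le hbdd ⟨ht, hc⟩) (not_le.2 htt)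
    have hhigh : ∀ t, t₀ < t → 0 ≤ D t := by
      intro t htt
      obtain ⟨s, hs, hst⟩ := exists_lt_of_csInf_lt hne htt
      exact hD s t hs.1 hst hs.2
    -- Subtracting `t₀ ^ (p - 2)` times the vanishing integral of `t * D t` leaves a weight that
    -- changes sign exactly where `D` does.
    have hrw : ∀ t : ℝ, 0 < t → (t ^ (p - 2) - t₀ ^ (p - 2)) * t * D t =
        t ^ (p - 1) * D t - t₀ ^ (p - 2) * (t * D t) := by
      intro t ht
      have : t ^ (p - 1) = t ^ (p - 2) * t := by
        rw [← Real.rpow_add_one ht.ne']; ring_nf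
      rw [this]; ring
    have hint : IntegrableOn (fun t => (t ^ (p - 2) - t₀ ^ (p - 2)) * t * D t) (Ioi 0) :=
      (integrableOn_congr_fun (fun t ht => hrw t ht) measurableSet_Ioi).2
        (i2.sub (i1.const_mul _))
    have hI : ∫ t in Ioi 0, (t ^ (p - 2) - t₀ ^ (p - 2)) * t * D t =
        ∫ t in Ioi 0, t ^ (p - 1) * D t := by
      rw [setIntegral_congr_fun measurableSet_Ioi (fun t ht => hrw t ht),
        integral_sub i2 (i1.const_mul _), integral_const_mul, z1]
      simp
    have hp2 : 0 < p - 2 := by linarith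
    have hnn : ∀ t, 0 < t → 0 ≤ (t ^ (p - 2) - t₀ ^ (p - 2)) * t * D t := by
      intro t ht
      rcases lt_trichotomy t t₀ with h | h | h
      · have h1 : t ^ (p - 2) ≤ t₀ ^ (p - 2) := Real.rpow_le_rpow ht.le h.le hp2.le
        exact mul_nonneg_of_nonpos_of_nonpos
          (mul_nonpos_of_nonpos_of_nonneg (by linarith) ht.le) (hlow t ht h)
      · rw [h]; simp
      · have h1 : t₀ ^ (p - 2) ≤ t ^ (p - 2) := Real.rpow_le_rpow ht₀ h.le hp2.le
        exact mul_nonneg (mul_nonneg (by linarith) ht.le) (hhigh t h)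
    have hae : 0 ≤ᵐ[volume.restrict (Ioi 0)] fun t => (t ^ (p - 2) - t₀ ^ (p - 2)) * t * D t :=
      (ae_restrict_mem measurableSet_Ioi).mono fun t ht => hnn t ht
    refine ⟨hI ▸ integral_nonneg_of_ae hae, fun h0 => ?_⟩
    rw [← hI, integral_eq_zero_iff_of_nonneg_ae hae hint] at h0
    refine ae_eq_zero_of_mul (t₀ := t₀) (fun t ht htt => ?_) h0
    refine mul_ne_zero (sub_ne_zero.2 fun h => htt ?_) ht.ne'
    exact (Real.rpow_left_inj ht.le ht₀ hp2.ne').1 h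
  · push Not at hP
    have hae : 0 ≤ᵐ[volume.restrict (Ioi 0)] fun t => -(t * D t) :=
      (ae_restrict_mem measurableSet_Ioi).mono fun t ht =>
        neg_nonneg.2 (mul_nonpos_of_nonneg_of_nonpos (le_of_lt ht) (hP t ht))
    have h0 : ∫ t in Ioi 0, -(t * D t) = 0 := by rw [integral_neg, z1, neg_zero]
    rw [integral_eq_zero_iff_of_nonneg_ae hae i1.neg] at h0
    have hD0 : D =ᵐ[volume.restrict (Ioi 0)] 0 := by
      refine ae_eq_zero_of_mul (w := fun t => -t) (t₀ := 0)
        (fun t ht _ => neg_ne_zero.2 ht.ne') ?_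
      filter_upwards [h0] with t ht
      simpa using ht
    refine ⟨le_of_eq ?_, fun _ => hD0⟩
    symm
    refine integral_eq_zero_of_ae ?_
    filter_upwards [hD0] with t ht
    simp [ht]

/-- A concave function lies below its chord outside, and above it inside, the interval where the
chord is taken. -/
lemma exists_chord_of_concaveOn {H : ℝ → ℝ} (hH : ConcaveOn ℝ (Ioi 0) H) {u₁ u₂ : ℝ}
    (h₁ : 0 < u₁) (h₁₂ : u₁ < u₂) :
    ∃ c d : ℝ, (∀ u, 0 < u → u ≤ u₁ → H u ≤ c + d * u) ∧
      (∀ u, u₁ ≤ u → u ≤ u₂ → c + d * u ≤ H u) ∧ (∀ u, u₂ ≤ u → H u ≤ c + d * u) := by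
  set d := (H u₂ - H u₁) / (u₂ - u₁) with hd
  have h21 : 0 < u₂ - u₁ := by linarith
  have hd' : d * (u₂ - u₁) = H u₂ - H u₁ := by rw [hd]; field_simp
  have m1 : u₁ ∈ Ioi (0 : ℝ) := h₁
  have m2 : u₂ ∈ Ioi (0 : ℝ) := h₁.trans h₁₂
  refine ⟨H u₁ - d * u₁, d, fun u hu hu1 => ?_, fun u hu1 hu2 => ?_, fun u hu2 => ?_⟩
  · rcases hu1.eq_or_lt with rfl | h
    · linarith
    have := hH.slope_anti_adjacent hu m2 h h₁₂
    rw [← hd, le_div_iff₀ (by linarith)] at this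
    linarith
  · rcases hu1.eq_or_lt with rfl | h
    · linarith
    rcases hu2.eq_or_lt with rfl | h'
    · linarith
    have := hH.slope_anti_adjacent m1 m2 h h'
    rw [div_le_div_iff₀ (by linarith) (by linarith)] at this
    have e : H u₂ = H u₁ + d * (u₂ - u₁) := by linarith
    rw [e] at this
    have : (d * (u - u₁)) * (u₂ - u₁) ≤ (H u - H u₁) * (u₂ - u₁) := by linarith
    have := le_of_mul_le_mul_right this h21
    linarith
  · rcases hu2.eq_or_lt with rfl | h
    · linarith
    have := hH.slope_anti_adjacent m1 (m2.trans h : (0 : ℝ) < u) h₁₂ h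
    rw [← hd, div_le_iff₀ (by linarith)] at this
    linarith

/-- If `D` is positive exactly on an interval and orthogonal to `t` and `t ^ (p - 1)`, then its
integral against `t H(t ^ (p - 2))` is nonnegative for every concave `H`. -/
lemma double_crossing {p : ℝ} (hp : 2 < p) {D G H : ℝ → ℝ} (hH : ConcaveOn ℝ (Ioi 0) H)
    (hG : ∀ t, 0 < t → G t = t * H (t ^ (p - 2)))
    (hD : OrdConnected {t | 0 < t ∧ 0 < D t})
    (i1 : IntegrableOn (fun t => t * D t) (Ioi 0))
    (i2 : IntegrableOn (fun t => t ^ (p - 1) * D t) (Ioi 0))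
    (i3 : IntegrableOn (fun t => G t * D t) (Ioi 0))
    (z1 : ∫ t in Ioi 0, t * D t = 0) (z2 : ∫ t in Ioi 0, t ^ (p - 1) * D t = 0) :
    0 ≤ ∫ t in Ioi 0, G t * D t := by
  have htriv : D =ᵐ[volume.restrict (Ioi 0)] 0 → 0 ≤ ∫ t in Ioi 0, G t * D t := by
    intro h
    refine (integral_eq_zero_of_ae ?_).ge
    filter_upwards [h] with t ht
    simp [ht]
  set P : Set ℝ := {t | 0 < t ∧ 0 < D t} with hPdef
  -- If `D` or `-D` has at most one sign change, from nonpositive to nonnegative, single crossing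
  -- makes `D` vanish almost everywhere. Otherwise `D` is negative somewhere on each side of its
  -- positivity interval.
  by_cases hup : ∀ t u, 0 < t → t < u → 0 < D t → 0 ≤ D u
  · exact htriv ((single_crossing hp hup i1 i2 z1).2 z2)
  by_cases hdown : ∀ t u, 0 < t → t < u → 0 < -D t → 0 ≤ -D u
  · have j1 : IntegrableOn (fun t => t * -D t) (Ioi 0) := by simpa using i1.neg
    have j2 : IntegrableOn (fun t => t ^ (p - 1) * -D t) (Ioi 0) := by simpa using i2.neg
    have y1 : ∫ t in Ioi 0, t * -D t = 0 := by simp [integral_neg, z1]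
    have y2 : ∫ t in Ioi 0, t ^ (p - 1) * -D t = 0 := by simp [integral_neg, z2]
    refine htriv ?_
    filter_upwards [(single_crossing hp hdown j1 j2 y1).2 y2] with t ht
    simpa using ht
  push Not at hup hdown
  obtain ⟨x, x', hx, hxx', hDx, hDx'⟩ := hup
  obtain ⟨z, z', hz, hzz', hDz, hDz'⟩ := hdown
  have mx : x ∈ P := ⟨hx, hDx⟩
  have mz : z' ∈ P := ⟨hz.trans hzz', by linarith⟩
  have hzP : z ∉ P := fun h => by have := h.2; linarith
  have hx'P : x' ∉ P := fun h => by have := h.2; linarith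
  have hbb : ∀ t ∈ P, z ≤ t := by
    intro t ht
    by_contra! hc
    exact hzP (hD.out ht mz ⟨hc.le, hzz'.le⟩)
  have hba : ∀ t ∈ P, t ≤ x' := by
    intro t ht
    by_contra! hc
    exact hx'P (hD.out mx ht ⟨hxx'.le, hc.le⟩)
  have bb : BddBelow P := ⟨z, hbb⟩
  have ba : BddAbove P := ⟨x', hba⟩
  have hne : P.Nonempty := ⟨x, mx⟩
  set t₁ := sInf P
  set t₂ := sSup P
  -- The left endpoint must be positive because `H` is concave on the open half-line only.
  have ht₁ : 0 < t₁ := hz.trans_le (le_csInf hne hbb)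
  have hin : ∀ t, t₁ < t → t < t₂ → 0 < D t := by
    intro t h1 h2
    obtain ⟨s, hs, hst⟩ := exists_lt_of_csInf_lt hne h1
    obtain ⟨v, hv, htv⟩ := exists_lt_of_lt_csSup hne h2
    exact (hD.out hs hv ⟨hst.le, htv.le⟩).2
  have hlow : ∀ t, 0 < t → t < t₁ → D t ≤ 0 := by
    intro t ht h
    by_contra! hc
    exact absurd (csInf_le bb ⟨ht, hc⟩) (not_le.2 h)
  have hhigh : ∀ t, 0 < t → t₂ < t → D t ≤ 0 := by
    intro t ht h
    by_contra! hc
    exact absurd (le_csSup ba ⟨ht, hc⟩) (not_le.2 h)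
  have h12 : t₁ ≤ t₂ := (csInf_le bb mx).trans (le_csSup ba mx)
  have hp2 : 0 < p - 2 := by linarith
  have hexp : ∀ t : ℝ, 0 < t → t ^ (p - 1) = t * t ^ (p - 2) := by
    intro t ht
    rw [mul_comm, ← Real.rpow_add_one ht.ne']; ring_nf
  rcases h12.eq_or_lt with h12 | h12
  -- A one-point positivity set is null, so `t * D t ≤ 0` almost everywhere with zero integral.
  · refine htriv ?_
    have hae : 0 ≤ᵐ[volume.restrict (Ioi 0)] fun t => -(t * D t) := by
      have hnt : ∀ᵐ t ∂(volume.restrict (Ioi (0 : ℝ))), t ≠ t₁ :=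
        ae_restrict_of_ae (by simp [ae_iff])
      filter_upwards [hnt, ae_restrict_mem measurableSet_Ioi] with t ht ht0
      refine neg_nonneg.2 (mul_nonpos_of_nonneg_of_nonpos (le_of_lt ht0) ?_)
      rcases ht.lt_or_gt with h | h
      · exact hlow t ht0 h
      · exact hhigh t ht0 (h12 ▸ h)
    have h0 : ∫ t in Ioi 0, -(t * D t) = 0 := by rw [integral_neg, z1, neg_zero]
    rw [integral_eq_zero_iff_of_nonneg_ae hae i1.neg] at h0
    refine ae_eq_zero_of_mul (w := fun t => -t) (t₀ := 0)
      (fun t ht _ => neg_ne_zero.2 ht.ne') ?_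
    filter_upwards [h0] with t ht
    simpa using ht
  · obtain ⟨c, d, hc1, hc2, hc3⟩ := exists_chord_of_concaveOn hH (Real.rpow_pos_of_pos ht₁ (p - 2))
      (Real.rpow_lt_rpow ht₁.le h12 hp2)
    have hle : ∀ᵐ t ∂(volume.restrict (Ioi (0 : ℝ))),
        c * (t * D t) + d * (t ^ (p - 1) * D t) ≤ G t * D t := by
      have hn1 : ∀ᵐ t ∂(volume.restrict (Ioi (0 : ℝ))), t ≠ t₁ :=
        ae_restrict_of_ae (by simp [ae_iff])
      have hn2 : ∀ᵐ t ∂(volume.restrict (Ioi (0 : ℝ))), t ≠ t₂ :=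
        ae_restrict_of_ae (by simp [ae_iff])
      filter_upwards [hn1, hn2, ae_restrict_mem measurableSet_Ioi] with t ht1 ht2 ht0
      have ht0 : 0 < t := ht0
      rw [hG t ht0, hexp t ht0]
      -- `H` minus its chord and `D` have the same sign on each of the three intervals cut out by
      -- `t₁` and `t₂`.
      suffices 0 ≤ t * ((H (t ^ (p - 2)) - (c + d * t ^ (p - 2))) * D t) by linarith
      refine mul_nonneg ht0.le ?_
      have hmono : ∀ {a b : ℝ}, 0 < a → a ≤ b → a ^ (p - 2) ≤ b ^ (p - 2) :=
        fun ha hab => Real.rpow_le_rpow ha.le hab hp2.le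
      rcases ht1.lt_or_gt with h | h
      · exact mul_nonneg_of_nonpos_of_nonpos
          (sub_nonpos.2 (hc1 _ (Real.rpow_pos_of_pos ht0 _) (hmono ht0 h.le))) (hlow t ht0 h)
      rcases ht2.lt_or_gt with h' | h'
      · exact mul_nonneg (sub_nonneg.2 (hc2 _ (hmono ht₁ h.le) (hmono ht0 h'.le)))
          (hin t h h').le
      · exact mul_nonneg_of_nonpos_of_nonpos
          (sub_nonpos.2 (hc3 _ (hmono (ht₁.trans h12) h'.le))) (hhigh t ht0 h')
    have := integral_mono_ae ((i1.const_mul c).add (i2.const_mul d)) i3 hle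
    rw [integral_add' (i1.const_mul c) (i2.const_mul d), integral_const_mul, integral_const_mul,
      z1, z2] at this
    simpa using this

/-! ### Tail functions -/

lemma tail_nonneg (μ : Measure ℝ) (t : ℝ) : 0 ≤ tail μ t := measureReal_nonneg

lemma tail_le_one (μ : Measure ℝ) [IsProbabilityMeasure μ] (t : ℝ) : tail μ t ≤ 1 :=
  measureReal_le_one

lemma tail_antitone (μ : Measure ℝ) [IsFiniteMeasure μ] : Antitone (tail μ) :=
  fun _ _ h => measureReal_mono fun _ hx => le_trans h hx

lemma tail_of_nonpos (μ : Measure ℝ) [IsProbabilityMeasure μ] {t : ℝ} (ht : t ≤ 0) :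
    tail μ t = 1 := by
  have : {x : ℝ | t ≤ |x|} = univ := eq_univ_of_forall fun x => ht.trans (abs_nonneg x)
  rw [tail, this, probReal_univ]

/-- Left continuity of the tail: `{t ≤ |x|}` is a decreasing intersection of such sets at levels
increasing to `t`. -/
lemma le_tail_of_forall_lt {μ : Measure ℝ} [IsFiniteMeasure μ] {t c : ℝ} (ht : 0 < t)
    (h : ∀ s, 0 < s → s < t → c ≤ tail μ s) : c ≤ tail μ t := by
  obtain ⟨u, hu, hut, hlim⟩ := exists_seq_strictMono_tendsto' ht
  have hset : (⋂ n, {x : ℝ | u n ≤ |x|}) = {x : ℝ | t ≤ |x|} := by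
    ext x
    simp only [mem_iInter, mem_ofPred_eq]
    exact ⟨fun hx => le_of_tendsto' hlim hx, fun hx n => (hut n).2.le.trans hx⟩
  have h1 := tendsto_measure_iInter_atTop (μ := μ) (s := fun n => {x : ℝ | u n ≤ |x|})
    (fun n => (measurableSet_le measurable_const measurable_norm).nullMeasurableSet)
    (fun m n hmn x hx => (hu.monotone hmn).trans hx) ⟨0, measure_ne_top _ _⟩
  rw [hset] at h1
  have h2 := (ENNReal.tendsto_toReal (measure_ne_top μ _)).comp h1
  exact ge_of_tendsto' h2 fun n => h (u n) (hut n).1 (hut n).2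

/-- A symmetric law is determined by its tail function. -/
lemma IsSymmetricLaw.ext {μ ν : Measure ℝ} (hμ : IsSymmetricLaw μ) (hν : IsSymmetricLaw ν)
    (h : ∀ t, 0 < t → tail μ t = tail ν t) : μ = ν := by
  have := hμ.isProbabilityMeasure
  have := hν.isProbabilityMeasure
  have habs : Measurable (fun x : ℝ => |x|) := measurable_norm
  have hmap : μ.map (fun x => |x|) = ν.map (fun x => |x|) := by
    have : IsProbabilityMeasure (μ.map (fun x => |x|)) :=
      Measure.isProbabilityMeasure_map habs.aemeasurable
    refine Measure.ext_of_Ici _ _ fun t => ?_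
    rw [Measure.map_apply habs measurableSet_Ici, Measure.map_apply habs measurableSet_Ici]
    have key : tail μ t = tail ν t := by
      rcases le_or_gt t 0 with ht | ht
      · rw [tail_of_nonpos μ ht, tail_of_nonpos ν ht]
      · exact h t ht
    exact (measureReal_eq_measureReal_iff).1 key
  -- By symmetry the law of `|X|` determines all integrals: `2 E f(X) = E (f |X| + f (-|X|))`.
  have key : ∀ (ρ : Measure ℝ), IsSymmetricLaw ρ → ∀ f : ℝ → ENNReal, Measurable f →
      2 * ∫⁻ x, f x ∂ρ = ∫⁻ z, (f z + f (-z)) ∂(ρ.map fun x => |x|) := by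
    intro ρ hρ f hf
    rw [lintegral_map (f := fun z => f z + f (-z)) (hf.add (hf.comp measurable_neg)) habs]
    have e : ∀ x : ℝ, f |x| + f (-|x|) = f x + f (-x) := by
      intro x
      rcases abs_choice x with hx | hx <;> rw [hx]
      rw [neg_neg, add_comm]
    simp_rw [e]
    rw [lintegral_add_left hf, two_mul]
    congr 1
    conv_lhs => rw [← hρ.map_neg]
    rw [lintegral_map hf measurable_neg]
  refine Measure.ext fun A hA => ?_
  have hf : Measurable (A.indicator (1 : ℝ → ENNReal)) := measurable_one.indicator hA
  have e := key μ hμ _ hf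
  rw [hmap, ← key ν hν _ hf, lintegral_indicator_one hA, lintegral_indicator_one hA] at e
  exact (ENNReal.mul_right_inj (by norm_num) (by norm_num)).1 e

/-- Tails that agree almost everywhere agree on a dense set; monotonicity and left continuity extend
this to every `t > 0`. -/
lemma IsSymmetricLaw.ext_ae {μ ν : Measure ℝ} (hμ : IsSymmetricLaw μ) (hν : IsSymmetricLaw ν)
    (h : (fun t => tail μ t - tail ν t) =ᵐ[volume.restrict (Ioi 0)] 0) : μ = ν := by
  have := hμ.isProbabilityMeasure
  have := hν.isProbabilityMeasure
  have hdense : ∀ s t : ℝ, 0 < s → s < t → ∃ r, s < r ∧ r < t ∧ tail μ r = tail ν r := by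
    intro s t hs hst
    have h1 : (fun t => tail μ t - tail ν t) =ᵐ[volume.restrict (Ioo s t)] 0 :=
      ae_mono (Measure.restrict_mono (fun x hx => hs.trans hx.1) le_rfl) h
    have hne : (ae (volume.restrict (Ioo s t))).NeBot := by
      rw [ae_neBot]
      intro h0
      have := Measure.restrict_eq_zero.1 h0
      simp [hst.not_ge] at this
    obtain ⟨r, hr, hm⟩ := (h1.and (ae_restrict_mem measurableSet_Ioo)).exists
    exact ⟨r, hm.1, hm.2, sub_eq_zero.1 hr⟩
  refine hμ.ext hν fun t ht => le_antisymm ?_ ?_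
  · refine le_tail_of_forall_lt ht fun s hs hst => ?_
    obtain ⟨r, h1, h2, h3⟩ := hdense s t hs hst
    exact (tail_antitone μ h2.le).trans (h3.le.trans (tail_antitone ν h1.le))
  · refine le_tail_of_forall_lt ht fun s hs hst => ?_
    obtain ⟨r, h1, h2, h3⟩ := hdense s t hs hst
    exact (tail_antitone ν h2.le).trans (h3.ge.trans (tail_antitone μ h1.le))

/-! ### Moments through tails -/

/-- Layer-cake formula for an even `f` with derivative `g`: `f x - f 0` is the integral of `g` over
`[0, |x|]`, and Tonelli exchanges the integrals. Finiteness of the left side yields the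
integrability of `g * tail`. -/
lemma integral_eq_add_integral_tail {μ : Measure ℝ} [IsProbabilityMeasure μ] {f g : ℝ → ℝ}
    (hf : ∀ x, f |x| = f x) (hfg : ∀ t, HasDerivAt f (g t) t) (hg : Continuous g)
    (hg0 : ∀ t, 0 < t → 0 ≤ g t) (hint : Integrable f μ) :
    IntegrableOn (fun t => g t * tail μ t) (Ioi 0) ∧
      ∫ x, f x ∂μ = f 0 + ∫ t in Ioi 0, g t * tail μ t := by
  have hFTC : ∀ x : ℝ, ∫ t in (0 : ℝ)..|x|, g t = f x - f 0 := by
    intro x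
    rw [intervalIntegral.integral_eq_sub_of_hasDerivAt (fun t _ => hfg t)
      (hg.intervalIntegrable _ _), hf]
  have hge : ∀ x : ℝ, 0 ≤ f x - f 0 := by
    intro x
    rw [← hFTC x]
    refine intervalIntegral.integral_nonneg_of_ae_restrict (abs_nonneg x) ?_
    rw [Measure.restrict_congr_set Ioc_ae_eq_Icc.symm]
    exact (ae_restrict_mem measurableSet_Ioc).mono fun t ht => hg0 t ht.1
  have key := lintegral_comp_eq_lintegral_meas_le_mul μ (f := fun x => |x|) (g := g)
    (Filter.Eventually.of_forall fun x => abs_nonneg x) measurable_norm.aemeasurable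
    (fun t _ => hg.intervalIntegrable _ _)
    ((ae_restrict_mem measurableSet_Ioi).mono fun t ht => hg0 t ht)
  simp_rw [hFTC] at key
  have hint' : Integrable (fun x => f x - f 0) μ := hint.sub (integrable_const _)
  rw [← ofReal_integral_eq_lintegral_ofReal hint' (Filter.Eventually.of_forall hge)] at key
  have hR : ∫⁻ t in Ioi 0, μ {a : ℝ | t ≤ |a|} * ENNReal.ofReal (g t) =
      ∫⁻ t in Ioi 0, ENNReal.ofReal (g t * tail μ t) := by
    refine setLIntegral_congr_fun measurableSet_Ioi fun t ht => ?_
    rw [ENNReal.ofReal_mul (hg0 t ht), mul_comm, tail, ofReal_measureReal]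
  rw [hR] at key
  have hmeas : AEStronglyMeasurable (fun t => g t * tail μ t) (volume.restrict (Ioi 0)) :=
    (hg.measurable.mul (tail_antitone μ).measurable).aestronglyMeasurable
  have hnn : 0 ≤ᵐ[volume.restrict (Ioi 0)] fun t => g t * tail μ t :=
    (ae_restrict_mem measurableSet_Ioi).mono fun t ht =>
      mul_nonneg (hg0 t ht) (tail_nonneg μ t)
  have hI : IntegrableOn (fun t => g t * tail μ t) (Ioi 0) :=
    ⟨hmeas, (hasFiniteIntegral_iff_ofReal hnn).2 (key ▸ ENNReal.ofReal_lt_top)⟩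
  refine ⟨hI, ?_⟩
  rw [integral_eq_lintegral_of_nonneg_ae hnn hmeas, ← key, ENNReal.toReal_ofReal
    (integral_nonneg hge), integral_sub hint (integrable_const _)]
  simp

lemma HasMoments.integrable_sq {p a b : ℝ} {μ : Measure ℝ} (h : HasMoments p a b μ)
    (ha : 0 < a) : Integrable (fun x : ℝ => x ^ 2) μ := by
  by_contra hc
  have := h.second
  rw [integral_undef hc] at this
  exact (pow_pos ha 2).ne this

lemma HasMoments.integrable_abs_rpow {p a b : ℝ} {μ : Measure ℝ} (h : HasMoments p a b μ)
    (hb : 0 < b) : Integrable (fun x : ℝ => |x| ^ p) μ := by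
  by_contra hc
  have := h.pth
  rw [integral_undef hc] at this
  exact (Real.rpow_pos_of_pos hb p).ne this

lemma integral_sq_eq_tail {μ : Measure ℝ} [IsProbabilityMeasure μ]
    (h : Integrable (fun x : ℝ => x ^ 2) μ) :
    IntegrableOn (fun t => t * tail μ t) (Ioi 0) ∧
      ∫ x, x ^ 2 ∂μ = 2 * ∫ t in Ioi 0, t * tail μ t := by
  obtain ⟨h1, h2⟩ := integral_eq_add_integral_tail (f := fun x : ℝ => x ^ 2)
    (g := fun t => 2 * t) (fun x => sq_abs x) (fun t => by simpa using hasDerivAt_pow 2 t)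
    (by fun_prop) (fun t ht => by positivity) h
  simp only [mul_assoc] at h1 h2
  refine ⟨?_, by rw [h2, integral_const_mul]; simp⟩
  simpa [IntegrableOn] using h1.const_mul (1 / 2 : ℝ)

lemma integral_abs_rpow_eq_tail {p : ℝ} (hp : 2 ≤ p) {μ : Measure ℝ} [IsProbabilityMeasure μ]
    (h : Integrable (fun x : ℝ => |x| ^ p) μ) :
    IntegrableOn (fun t => t ^ (p - 1) * tail μ t) (Ioi 0) ∧
      ∫ x, |x| ^ p ∂μ = p * ∫ t in Ioi 0, t ^ (p - 1) * tail μ t := by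
  have hc : Continuous fun t : ℝ => p * |t| ^ (p - 2) * t :=
    (continuous_const.mul (continuous_abs.rpow_const fun _ => Or.inr (by linarith))).mul
      continuous_id
  obtain ⟨h1, h2⟩ := integral_eq_add_integral_tail (f := fun x : ℝ => |x| ^ p)
    (g := fun t => p * |t| ^ (p - 2) * t) (fun x => by simp)
    (fun t => hasDerivAt_abs_rpow t (by linarith)) hc
    (fun t ht => by positivity) h
  have e : EqOn (fun t => p * |t| ^ (p - 2) * t * tail μ t)
      (fun t => p * (t ^ (p - 1) * tail μ t)) (Ioi 0) := by
    intro t ht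
    have ht : 0 < t := ht
    have : t ^ (p - 1) = t ^ (p - 2) * t := by rw [← Real.rpow_add_one ht.ne']; ring_nf
    simp only [abs_of_pos ht, this]
    ring
  rw [integrableOn_congr_fun e measurableSet_Ioi] at h1
  rw [setIntegral_congr_fun measurableSet_Ioi e, integral_const_mul] at h2
  have hp0 : p ≠ 0 := by linarith
  refine ⟨?_, by rw [h2]; simp [Real.zero_rpow hp0]⟩
  have := h1.const_mul (1 / p)
  simpa [IntegrableOn, ← mul_assoc, hp0] using this

/-! ### Shifted moments of symmetric laws -/

lemma memLp_of_integrable_abs_rpow {Ω : Type*} [MeasurableSpace Ω] {P : Measure Ω} {p : ℝ}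
    (hp : 0 < p) {X : Ω → ℝ} (hX : AEStronglyMeasurable X P) :
    Integrable (fun ω => |X ω| ^ p) P ↔ MemLp X (ENNReal.ofReal p) P := by
  rw [← integrable_norm_rpow_iff hX (by simpa using hp) ENNReal.ofReal_ne_top]
  simp [ENNReal.toReal_ofReal hp.le]

lemma integrable_abs_add_rpow {μ : Measure ℝ} [IsFiniteMeasure μ] {p : ℝ} (hp : 0 < p)
    (h : Integrable (fun x : ℝ => |x| ^ p) μ) (y : ℝ) :
    Integrable (fun x : ℝ => |x + y| ^ p) μ := by
  rw [memLp_of_integrable_abs_rpow hp (by fun_prop)] at h ⊢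
  exact h.add (memLp_const y)

lemma IsSymmetricLaw.integral_neg {μ : Measure ℝ} (h : IsSymmetricLaw μ) (f : ℝ → ℝ) :
    ∫ x, f (-x) ∂μ = ∫ x, f x ∂μ := by
  conv_rhs => rw [← h.map_neg]
  exact (integral_map_equiv (MeasurableEquiv.neg ℝ) f).symm

lemma IsSymmetricLaw.integral_shift {μ : Measure ℝ} (h : IsSymmetricLaw μ) {p : ℝ} (hp : 0 < p)
    (hint : Integrable (fun x : ℝ => |x| ^ p) μ) (y : ℝ) :
    ∫ x, |x + y| ^ p ∂μ = ∫ x, (|x + y| ^ p + |x - y| ^ p) / 2 ∂μ := by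
  have := h.isProbabilityMeasure
  have e : ∫ x, |x - y| ^ p ∂μ = ∫ x, |x + y| ^ p ∂μ := by
    rw [← h.integral_neg fun x => |x - y| ^ p]
    refine integral_congr_ae (Filter.Eventually.of_forall fun x => ?_)
    simp only
    rw [← abs_neg, neg_sub, sub_neg_eq_add, add_comm]
  have hi : Integrable (fun x : ℝ => |x - y| ^ p) μ := by
    simpa [sub_eq_add_neg] using integrable_abs_add_rpow hp hint (-y)
  rw [integral_div, integral_add (integrable_abs_add_rpow hp hint y) hi, e]
  ring

/-- If two symmetric laws share the second and the `p`-th moment, and the tail of `μ` exceeds that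
of `ν` exactly on an interval, then all shifted `p`-th moments of `μ` dominate those of `ν`. -/
lemma integral_shift_le {p a b : ℝ} (hp : 4 < p) (ha : 0 < a) (hb : 0 < b) {μ ν : Measure ℝ}
    (hμ : IsSymmetricLaw μ) (hν : IsSymmetricLaw ν) (mμ : HasMoments p a b μ)
    (mν : HasMoments p a b ν)
    (hD : OrdConnected {t | 0 < t ∧ 0 < tail μ t - tail ν t}) (y : ℝ) :
    ∫ x, |x + y| ^ p ∂ν ≤ ∫ x, |x + y| ^ p ∂μ := by
  have := hμ.isProbabilityMeasure
  have := hν.isProbabilityMeasure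
  -- By symmetry of both laws, `y` and `-y` give the same shifted moments.
  wlog hy : 0 ≤ y generalizing y
  · have e : ∀ ρ : Measure ℝ, IsSymmetricLaw ρ →
        ∫ x, |x + y| ^ p ∂ρ = ∫ x, |x + -y| ^ p ∂ρ := by
      intro ρ hρ
      rw [← hρ.integral_neg]
      refine integral_congr_ae (Filter.Eventually.of_forall fun x => ?_)
      simp only
      rw [← abs_neg, neg_add, neg_neg]
    rw [e μ hμ, e ν hν]
    exact this (-y) (by linarith)
  have hp0 : 0 < p := by linarith
  have iμ := mμ.integrable_abs_rpow hb
  have iν := mν.integrable_abs_rpow hb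
  have hsymm : ∀ ρ : Measure ℝ, IsProbabilityMeasure ρ → Integrable (fun x : ℝ => |x| ^ p) ρ →
      IntegrableOn (fun t => shiftWeight p y t * tail ρ t) (Ioi 0) ∧
      ∫ x, (|x + y| ^ p + |x - y| ^ p) / 2 ∂ρ =
        (|0 + y| ^ p + |0 - y| ^ p) / 2 + ∫ t in Ioi 0, shiftWeight p y t * tail ρ t := by
    intro ρ _ hρ
    have hi : Integrable (fun x : ℝ => |x - y| ^ p) ρ := by
      simpa [sub_eq_add_neg] using integrable_abs_add_rpow hp0 hρ (-y)
    refine integral_eq_add_integral_tail (f := fun x => (|x + y| ^ p + |x - y| ^ p) / 2)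
      (fun x => ?_) (hasDerivAt_symm_shift (by linarith) y)
      (continuous_shiftWeight (by linarith) y)
      (fun t ht => shiftWeight_nonneg (by linarith) hy ht.le)
      (((integrable_abs_add_rpow hp0 hρ y).add hi).div_const 2)
    rcases abs_choice x with hx | hx <;> rw [hx]
    rw [← abs_neg (-x + y), ← abs_neg (-x - y), neg_add, neg_neg, neg_sub, sub_neg_eq_add,
      ← sub_eq_add_neg, add_comm, add_comm y x]
  obtain ⟨w1, w2⟩ := hsymm μ inferInstance iμ
  obtain ⟨v1, v2⟩ := hsymm ν inferInstance iν
  obtain ⟨q1, q2⟩ := integral_sq_eq_tail (mμ.integrable_sq ha)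
  obtain ⟨r1, r2⟩ := integral_sq_eq_tail (mν.integrable_sq ha)
  obtain ⟨q3, q4⟩ := integral_abs_rpow_eq_tail (by linarith) iμ
  obtain ⟨r3, r4⟩ := integral_abs_rpow_eq_tail (by linarith) iν
  rw [mμ.second] at q2
  rw [mν.second] at r2
  rw [mμ.pth] at q4
  rw [mν.pth] at r4
  have hsub : ∀ w : ℝ → ℝ, (fun t => w t * (tail μ t - tail ν t)) =
      fun t => w t * tail μ t - w t * tail ν t := fun w => by ext t; ring
  have key := double_crossing (by linarith : 2 < p) (concaveOn_shiftWeight hp hy)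
    (G := shiftWeight p y) (D := fun t => tail μ t - tail ν t)
    (fun t ht => by
      rw [Real.rpow_rpow_inv ht.le (by linarith)]
      field_simp) hD
    (by rw [hsub]; exact q1.sub r1) (by rw [hsub]; exact q3.sub r3)
    (by rw [hsub]; exact w1.sub v1)
    (by rw [hsub fun t => t, integral_sub q1 r1]; linarith)
    (by
      rw [hsub fun t => t ^ (p - 1), integral_sub q3 r3]
      have : p * ((∫ t in Ioi 0, t ^ (p - 1) * tail μ t) -
        ∫ t in Ioi 0, t ^ (p - 1) * tail ν t) = 0 := by linarith
      exact (mul_eq_zero.1 this).resolve_left hp0.ne')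
  rw [hsub, integral_sub w1 v1] at key
  rw [hμ.integral_shift hp0 iμ, hν.integral_shift hp0 iν, w2, v2]
  linarith

/-- Single crossing of tails: if the second moments agree and the tail of `μ` stays above that of
`ν` once it exceeds it, then the `p`-th moment of `μ` is the larger one. Equality forces `μ = ν`. -/
lemma abs_rpow_moment_le {p : ℝ} (hp : 2 < p) {μ ν : Measure ℝ}
    (hμ : IsSymmetricLaw μ) (hν : IsSymmetricLaw ν)
    (sμ : Integrable (fun x : ℝ => x ^ 2) μ) (sν : Integrable (fun x : ℝ => x ^ 2) ν)
    (iμ : Integrable (fun x : ℝ => |x| ^ p) μ) (iν : Integrable (fun x : ℝ => |x| ^ p) ν)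
    (hsq : ∫ x, x ^ 2 ∂μ = ∫ x, x ^ 2 ∂ν)
    (hD : ∀ t u, 0 < t → t < u → tail ν t < tail μ t → tail ν u ≤ tail μ u) :
    ∫ x, |x| ^ p ∂ν ≤ ∫ x, |x| ^ p ∂μ ∧ (∫ x, |x| ^ p ∂ν = ∫ x, |x| ^ p ∂μ → μ = ν) := by
  have := hμ.isProbabilityMeasure
  have := hν.isProbabilityMeasure
  obtain ⟨q1, q2⟩ := integral_sq_eq_tail sμ
  obtain ⟨r1, r2⟩ := integral_sq_eq_tail sν
  obtain ⟨q3, q4⟩ := integral_abs_rpow_eq_tail hp.le iμ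
  obtain ⟨r3, r4⟩ := integral_abs_rpow_eq_tail hp.le iν
  have hsub : ∀ w : ℝ → ℝ, (fun t => w t * (tail μ t - tail ν t)) =
      fun t => w t * tail μ t - w t * tail ν t := fun w => by ext t; ring
  obtain ⟨k1, k2⟩ := single_crossing hp (D := fun t => tail μ t - tail ν t)
    (fun t u ht htu h => sub_nonneg.2 (hD t u ht htu (sub_pos.1 h)))
    (by rw [hsub]; exact q1.sub r1) (by rw [hsub]; exact q3.sub r3)
    (by rw [hsub fun t => t, integral_sub q1 r1]; linarith)
  rw [hsub fun t => t ^ (p - 1), integral_sub q3 r3] at k1 k2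
  rw [q4, r4]
  have hp0 : 0 < p := by linarith
  refine ⟨mul_le_mul_of_nonneg_left (by linarith) hp0.le, fun h => hμ.ext_ae hν (k2 ?_)⟩
  rw [mul_right_inj' hp0.ne'] at h
  linarith

/-! ### The extremal classes -/

lemma exists_weight {s m t : ℝ} (h1 : s < m) (h2 : m < t) :
    ∃ w : ℝ, 0 < w ∧ w < 1 ∧ w * s + (1 - w) * t = m := by
  have : 0 < t - s := by linarith
  refine ⟨(t - m) / (t - s), div_pos (by linarith) this, ?_, ?_⟩
  · rw [div_lt_one this]; linarith
  · field_simp; ring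

/-- `S` equals `1` on `[0, β]` and is log-affine on `[β, ∞)`. -/
structure IsMinusTail (β : ℝ) (S : ℝ → ℝ) : Prop where
  nonneg : 0 ≤ β
  eq_one : ∀ t, 0 ≤ t → t ≤ β → S t = 1
  log_affine : ∀ s t w, β ≤ s → β ≤ t → 0 < w → w < 1 →
    S (w * s + (1 - w) * t) = S s ^ w * S t ^ (1 - w)

/-- `S` equals `exp (-α t)` on an initial interval `J` of `[0, ∞)` and vanishes beyond it. -/
structure IsPlusTail (α : ℝ) (J : Set ℝ) (S : ℝ → ℝ) : Prop where
  zero_mem : (0 : ℝ) ∈ J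
  ordConnected : J.OrdConnected
  eq_exp : ∀ t ∈ J, 0 ≤ t → S t = Real.exp (-(α * t))
  eq_zero : ∀ t, t ∉ J → 0 ≤ t → S t = 0

/-- The multiplicative form of log-affinity tolerates zeros, so `α = ∞` is covered as well: a
positive power of `0` is `0`. -/
lemma exists_isMinusTail {μ : Measure ℝ} (h : μ ∈ GMinus) : ∃ β, IsMinusTail β (tail μ) := by
  rcases h.2 with ⟨α, β, hα, hβ, hT⟩ | ⟨β, hβ, hT⟩
  · refine ⟨β, hβ, fun t ht htβ => ?_, fun s t w hs ht hw hw1 => ?_⟩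
    · rw [hT t ht, max_eq_right (by linarith)]; simp
    · have hm : β ≤ w * s + (1 - w) * t := by nlinarith
      rw [hT s (by linarith), hT t (by linarith), hT _ (by linarith), max_eq_left (by linarith),
        max_eq_left (by linarith), max_eq_left (by linarith), ← Real.exp_mul, ← Real.exp_mul,
        ← Real.exp_add]
      congr 1; ring
  · have hone : ∀ t, 0 ≤ t → t ≤ β → tail μ t = 1 := fun t h1 h2 => by
      rw [hT t h1, indicator_of_mem (show t ∈ Icc 0 β from ⟨h1, h2⟩)]
    have hzero : ∀ t, β < t → tail μ t = 0 := fun t h1 => by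
      rw [hT t (by linarith), indicator_of_notMem fun h => by have := h.2; linarith]
    refine ⟨β, hβ, hone, fun s t w hs ht hw hw1 => ?_⟩
    have hw2 : 0 < 1 - w := by linarith
    rcases hs.eq_or_lt with rfl | hs'
    · rcases ht.eq_or_lt with rfl | ht'
      · rw [show w * β + (1 - w) * β = β by ring, hone β hβ le_rfl]; simp
      · rw [hzero _ (by nlinarith), hzero t ht', Real.zero_rpow hw2.ne', mul_zero]
    · rw [hzero _ (by nlinarith), hzero s hs', Real.zero_rpow hw.ne', zero_mul]

lemma exists_isPlusTail {μ : Measure ℝ} (h : μ ∈ GPlus) :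
    ∃ α J, 0 ≤ α ∧ IsPlusTail α J (tail μ) := by
  rcases h.2 with ⟨α, β, hα, hβ, hT⟩ | ⟨α, hα, hT⟩
  · refine ⟨α, Icc 0 β, hα, ⟨le_rfl, hβ⟩, ordConnected_Icc, fun t ht h0 => ?_, fun t ht h0 => ?_⟩
    · rw [hT t h0, indicator_of_mem ht]
    · rw [hT t h0, indicator_of_notMem ht]
  · exact ⟨α, univ, hα, mem_univ _, ordConnected_univ, fun t _ h0 => hT t h0,
      fun t ht _ => absurd (mem_univ t) ht⟩

/-- The tail at `t` equals the tail at `max t β`; convexity of `max · β` and monotonicity then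
reduce to the log-affine range. -/
lemma hasLogConcaveTail_of_mem_gMinus {μ : Measure ℝ} (h : μ ∈ GMinus) :
    HasLogConcaveTail μ := by
  have := h.1.isProbabilityMeasure
  obtain ⟨β, hβ⟩ := exists_isMinusTail h
  have hmax : ∀ t, 0 ≤ t → tail μ t = tail μ (max t β) := by
    intro t ht
    rcases le_total t β with htb | htb
    · rw [max_eq_right htb, hβ.eq_one t ht htb, hβ.eq_one β hβ.nonneg le_rfl]
    · rw [max_eq_left htb]
  intro s t hs ht w hw hw1
  have hw2 : 0 < 1 - w := by linarith
  rw [hmax s hs, hmax t ht, hmax (w * s + (1 - w) * t) (by positivity),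
    ← hβ.log_affine _ _ w (le_max_right _ _) (le_max_right _ _) hw hw1]
  refine tail_antitone μ (max_le ?_ ?_)
  · exact add_le_add (mul_le_mul_of_nonneg_left (le_max_left _ _) hw.le)
      (mul_le_mul_of_nonneg_left (le_max_left _ _) hw2.le)
  · have h1 := mul_le_mul_of_nonneg_left (le_max_right s β) hw.le
    have h2 := mul_le_mul_of_nonneg_left (le_max_right t β) hw2.le
    linarith

lemma hasLogConcaveTail_of_mem_gPlus {μ : Measure ℝ} (h : μ ∈ GPlus) :
    HasLogConcaveTail μ := by
  obtain ⟨α, J, -, hJ⟩ := exists_isPlusTail h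
  intro s t hs ht w hw hw1
  have hw2 : 0 < 1 - w := by linarith
  by_cases hsJ : s ∈ J
  · by_cases htJ : t ∈ J
    · have hm : w * s + (1 - w) * t ∈ J :=
        hJ.ordConnected.convex hsJ htJ hw.le hw2.le (by ring)
      rw [hJ.eq_exp s hsJ hs, hJ.eq_exp t htJ ht, hJ.eq_exp _ hm (by positivity),
        ← Real.exp_mul, ← Real.exp_mul, ← Real.exp_add]
      apply le_of_eq; congr 1; ring
    · rw [hJ.eq_zero t htJ ht, Real.zero_rpow hw2.ne', mul_zero]
      exact tail_nonneg _ _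
  · rw [hJ.eq_zero s hsJ hs, Real.zero_rpow hw.ne', zero_mul]
    exact tail_nonneg _ _

/-- The tail of `ν` is `1` up to `β`, so an excess occurs only beyond `β`. There a log-concave
function is compared with a log-affine one, and the inequality at two points passes to every point
between them. -/
lemma ordConnected_tail_sub_gMinus {μ ν : Measure ℝ} [IsProbabilityMeasure μ]
    (hμ : HasLogConcaveTail μ) (hν : ν ∈ GMinus) :
    OrdConnected {t | 0 < t ∧ 0 < tail μ t - tail ν t} := by
  obtain ⟨β, hβ⟩ := exists_isMinusTail hν
  have hgt : ∀ t, 0 < t → 0 < tail μ t - tail ν t → β < t := by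
    intro t ht h
    by_contra! hc
    rw [hβ.eq_one t ht.le hc] at h
    linarith [tail_le_one μ t]
  refine ⟨fun s hs t ht m hm => ?_⟩
  rcases hm.1.eq_or_lt with rfl | h1
  · exact hs
  rcases hm.2.eq_or_lt with rfl | h2
  · exact ht
  obtain ⟨w, hw, hw1, rfl⟩ := exists_weight h1 h2
  have hw2 : 0 < 1 - w := by linarith
  refine ⟨hs.1.trans h1, sub_pos.2 ?_⟩
  rw [hβ.log_affine s t w (hgt s hs.1 hs.2).le (hgt t ht.1 ht.2).le hw hw1]
  refine lt_of_lt_of_le ?_ (hμ s t hs.1.le ht.1.le w hw hw1)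
  have a1 := Real.rpow_lt_rpow (tail_nonneg ν s) (sub_pos.1 hs.2) hw
  have a2 := Real.rpow_lt_rpow (tail_nonneg ν t) (sub_pos.1 ht.2) hw2
  exact mul_lt_mul'' a1 a2 (Real.rpow_nonneg (tail_nonneg _ _) _)
    (Real.rpow_nonneg (tail_nonneg _ _) _)

/-- Once the tail of `ν ∈ GPlus` exceeds a log-concave tail, it does so until it vanishes. -/
lemma IsPlusTail.tail_lt {μ ν : Measure ℝ} [IsProbabilityMeasure μ]
    (hμ : HasLogConcaveTail μ) {α : ℝ} {J : Set ℝ} (hJ : IsPlusTail α J (tail ν)) {s m : ℝ}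
    (hs : 0 < s) (hsm : s < m) (h : tail μ s < tail ν s) (hm : m ∈ J) : tail μ m < tail ν m := by
  have hm0 : 0 < m := hs.trans hsm
  have hsJ : s ∈ J := hJ.ordConnected.out hJ.zero_mem hm ⟨hs.le, hsm.le⟩
  by_contra! hc
  obtain ⟨w, hw, hw1, hws⟩ := exists_weight hs hsm
  have hw2 : 0 < 1 - w := by linarith
  -- Here `1 - w = s / m`. Since the tail of `μ` is `1` at `0`, log-concavity gives `tail μ m ^ (s /
  -- m) ≤ tail μ s`, and the left side is at least `exp (-α s)` by `hc`.
  have h1 := hμ 0 m le_rfl hm0.le w hw hw1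
  rw [hws, tail_of_nonpos μ le_rfl, Real.one_rpow, one_mul] at h1
  have h2 := Real.rpow_le_rpow (tail_nonneg ν m) hc hw2.le
  rw [hJ.eq_exp m hm hm0.le, ← Real.exp_mul] at h2
  rw [hJ.eq_exp s hsJ hs.le] at h
  have : -(α * m) * (1 - w) = -(α * s) := by rw [← hws]; ring
  rw [this] at h2
  linarith

/-- An excess forces `t ∈ J`, because the tail of `ν` vanishes off `J`; and within `J` an excess
persists by `IsPlusTail.tail_lt`. -/
lemma ordConnected_gPlus_sub_tail {μ ν : Measure ℝ} [IsProbabilityMeasure μ]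
    (hμ : HasLogConcaveTail μ) (hν : ν ∈ GPlus) :
    OrdConnected {t | 0 < t ∧ 0 < tail ν t - tail μ t} := by
  obtain ⟨α, J, -, hJ⟩ := exists_isPlusTail hν
  refine ⟨fun s hs t ht m hm => ?_⟩
  rcases hm.1.eq_or_lt with rfl | h1
  · exact hs
  have htJ : t ∈ J := by
    by_contra hc
    have h := ht.2
    rw [hJ.eq_zero t hc ht.1.le] at h
    linarith [tail_nonneg μ t]
  have hmJ : m ∈ J := hJ.ordConnected.out hJ.zero_mem htJ ⟨(hs.1.trans h1).le, hm.2⟩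
  exact ⟨hs.1.trans h1, sub_pos.2 (hJ.tail_lt hμ hs.1 h1 (sub_pos.1 hs.2) hmJ)⟩

/-! ### Uniqueness in the extremal classes -/

lemma HasMoments.eq_of_crossing {p a b : ℝ} (hp : 2 < p) (ha : 0 < a) (hb : 0 < b)
    {μ ν : Measure ℝ} (hμ : IsSymmetricLaw μ) (hν : IsSymmetricLaw ν)
    (mμ : HasMoments p a b μ) (mν : HasMoments p a b ν)
    (hD : ∀ t u, 0 < t → t < u → tail ν t < tail μ t → tail ν u ≤ tail μ u) : μ = ν :=
  (abs_rpow_moment_le hp hμ hν (mμ.integrable_sq ha) (mν.integrable_sq ha)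
    (mμ.integrable_abs_rpow hb) (mν.integrable_abs_rpow hb)
    (mμ.second.trans mν.second.symm) hD).2 (mν.pth.trans mμ.pth.symm)

/-- Let `β ≤ γ`. The tail of `μ` can exceed that of `ν` only beyond `γ`, where both are log-affine.
At `γ` the tail of `ν` is `1`, hence not the smaller one, so an excess of `μ` at `t` persists at
every later point. -/
lemma gMinus_unique {p a b : ℝ} (hp : 2 < p) (ha : 0 < a) (hb : 0 < b) {μ ν : Measure ℝ}
    (hμ : μ ∈ GMinus) (hν : ν ∈ GMinus) (mμ : HasMoments p a b μ) (mν : HasMoments p a b ν) :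
    μ = ν := by
  obtain ⟨β, hβ⟩ := exists_isMinusTail hμ
  obtain ⟨γ, hγ⟩ := exists_isMinusTail hν
  wlog hle : β ≤ γ generalizing μ ν β γ
  · exact (this hν hμ mν mμ γ hγ β hβ (le_of_not_ge hle)).symm
  have := hμ.1.isProbabilityMeasure
  refine mμ.eq_of_crossing hp ha hb hμ.1 hν.1 mν fun t u ht htu h => ?_
  by_contra! hc
  have hγt : γ < t := by
    by_contra! h'
    rw [hγ.eq_one t ht.le h'] at h
    linarith [tail_le_one μ t]
  obtain ⟨w, hw, hw1, hwt⟩ := exists_weight hγt htu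
  have hw2 : 0 < 1 - w := by linarith
  have e1 := hβ.log_affine γ u w hle (by linarith) hw hw1
  have e2 := hγ.log_affine γ u w le_rfl (by linarith) hw hw1
  rw [hwt] at e1 e2
  rw [hγ.eq_one γ hγ.nonneg le_rfl, Real.one_rpow, one_mul] at e2
  have h1 : tail μ γ ^ w ≤ 1 := Real.rpow_le_one (tail_nonneg _ _) (tail_le_one _ _) hw.le
  have h2 : tail μ u ^ (1 - w) ≤ tail ν u ^ (1 - w) :=
    Real.rpow_le_rpow (tail_nonneg _ _) hc.le hw2.le
  have h3 : tail μ t ≤ tail μ u ^ (1 - w) := by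
    rw [e1]
    exact mul_le_of_le_one_left (Real.rpow_nonneg (tail_nonneg _ _) _) h1
  linarith

/-- The law with the smaller rate has the larger tail as long as its tail has not been cut off. The
other tail can exceed it only after the cut-off, where the first is zero. -/
lemma gPlus_unique {p a b : ℝ} (hp : 2 < p) (ha : 0 < a) (hb : 0 < b) {μ ν : Measure ℝ}
    (hμ : μ ∈ GPlus) (hν : ν ∈ GPlus) (mμ : HasMoments p a b μ) (mν : HasMoments p a b ν) :
    μ = ν := by
  obtain ⟨α, J, -, hJ⟩ := exists_isPlusTail hμ
  obtain ⟨β, K, -, hK⟩ := exists_isPlusTail hν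
  wlog hle : α ≤ β generalizing μ ν α β J K
  · exact (this hν hμ mν mμ β K hK α J hJ (le_of_not_ge hle)).symm
  refine (mν.eq_of_crossing hp ha hb hν.1 hμ.1 mμ fun t u ht htu h => ?_).symm
  have htJ : t ∉ J := by
    intro htJ
    by_cases htK : t ∈ K
    · rw [hJ.eq_exp t htJ ht.le, hK.eq_exp t htK ht.le, Real.exp_lt_exp] at h
      nlinarith
    · rw [hK.eq_zero t htK ht.le] at h
      linarith [tail_nonneg μ t]
  have huJ : u ∉ J := fun hu => htJ (hJ.ordConnected.out hJ.zero_mem hu ⟨ht.le, htu.le⟩)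
  rw [hJ.eq_zero u huJ (ht.trans htu).le]
  exact tail_nonneg _ _

/-! ### Symmetric laws driven by an exponential variable -/

/-- The standard exponential law. -/
noncomputable def stdExp : Measure ℝ :=
  (volume.restrict (Ioi 0)).withDensity fun x => ENNReal.ofReal (Real.exp (-x))

lemma stdExp_Ici {u : ℝ} (hu : 0 ≤ u) : stdExp {x | u ≤ x} = ENNReal.ofReal (Real.exp (-u)) := by
  have hm : MeasurableSet {x : ℝ | u ≤ x} := measurableSet_Ici
  have hset : ({x : ℝ | u ≤ x} ∩ Ioi 0 : Set ℝ) =ᵐ[volume] Ioi u := by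
    rcases hu.eq_or_lt with rfl | hu
    · refine Filter.EventuallyEq.of_eq ?_
      exact inter_eq_right.2 fun x (hx : 0 < x) => hx.le
    · have : ({x : ℝ | u ≤ x} ∩ Ioi 0 : Set ℝ) = Ici u := by
        exact inter_eq_left.2 fun x hx => hu.trans_le hx
      rw [this]
      exact Ioi_ae_eq_Ici.symm
  have hint : IntegrableOn (fun x : ℝ => Real.exp (-x)) (Ioi u) := by
    simpa using exp_neg_integrableOn_Ioi u one_pos
  rw [stdExp, withDensity_apply _ hm, Measure.restrict_restrict hm,
    Measure.restrict_congr_set hset, ← integral_exp_neg_Ioi,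
    ofReal_integral_eq_lintegral_ofReal hint
      (Filter.Eventually.of_forall fun x => (Real.exp_pos _).le)]

lemma ae_stdExp_pos : ∀ᵐ x ∂stdExp, 0 < x :=
  (withDensity_absolutelyContinuous _ _).ae_le (ae_restrict_mem measurableSet_Ioi)

instance : IsProbabilityMeasure stdExp := by
  refine ⟨?_⟩
  have h := stdExp_Ici le_rfl
  rw [neg_zero, Real.exp_zero, ENNReal.ofReal_one] at h
  rw [← h]
  refine measure_congr ?_
  filter_upwards [ae_stdExp_pos] with x hx
  exact (eq_iff_iff.2 ⟨fun _ => hx.le, fun _ => trivial⟩)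

/-- The dominating function for all interpolating families; it rests on the convergence of the Gamma
integral. -/
lemma integrable_one_add_rpow_stdExp {q : ℝ} (hq : 0 < q) :
    Integrable (fun x : ℝ => (1 + x) ^ q) stdExp := by
  have h1 : Integrable (fun x : ℝ => |x| ^ q) stdExp := by
    rw [stdExp, integrable_withDensity_iff_integrable_smul' (by fun_prop)
      (Filter.Eventually.of_forall fun x => ENNReal.ofReal_lt_top)]
    have h := Real.GammaIntegral_convergent (s := q + 1) (by linarith)
    refine (integrableOn_congr_fun (fun x hx => ?_) measurableSet_Ioi).1 h
    have hx : 0 < x := hx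
    simp [ENNReal.toReal_ofReal (Real.exp_pos _).le, abs_of_pos hx]
  refine (integrable_abs_add_rpow hq h1 1).congr ?_
  filter_upwards [ae_stdExp_pos] with x hx
  rw [abs_of_pos (by linarith), add_comm]

/-- The law of `ε W`, where `W` has law `ρ` and `ε` is an independent random sign. -/
noncomputable def symmetrize (ρ : Measure ℝ) : Measure ℝ :=
  (2⁻¹ : ENNReal) • ρ + (2⁻¹ : ENNReal) • ρ.map (fun x => -x)

lemma isSymmetricLaw_symmetrize (ρ : Measure ℝ) [IsProbabilityMeasure ρ] :
    IsSymmetricLaw (symmetrize ρ) := by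
  have : IsProbabilityMeasure (ρ.map fun x => -x) :=
    Measure.isProbabilityMeasure_map measurable_neg.aemeasurable
  refine ⟨⟨?_⟩, ?_⟩
  · simp [symmetrize, ENNReal.inv_two_add_inv_two]
  · have h : (fun x : ℝ => -x) ∘ (fun x : ℝ => -x) = id := by ext; simp
    rw [symmetrize, Measure.map_add _ _ measurable_neg, Measure.map_smul, Measure.map_smul,
      Measure.map_map measurable_neg measurable_neg, h, Measure.map_id, add_comm]

lemma integral_symmetrize {ρ : Measure ℝ} {f : ℝ → ℝ} (hf : ∀ x, f (-x) = f x)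
    (hi : Integrable f ρ) :
    Integrable f (symmetrize ρ) ∧ ∫ x, f x ∂(symmetrize ρ) = ∫ x, f x ∂ρ := by
  have hcomp : f ∘ (MeasurableEquiv.neg ℝ) = f := funext hf
  have hi' : Integrable f (ρ.map fun x => -x) :=
    (integrable_map_equiv (MeasurableEquiv.neg ℝ) f).2 (by rwa [hcomp])
  have he : ∫ x, f x ∂(ρ.map fun x => -x) = ∫ x, f x ∂ρ := by
    refine (integral_map_equiv (MeasurableEquiv.neg ℝ) f).trans ?_
    exact integral_congr_ae (Filter.Eventually.of_forall hf)
  have j1 := hi.smul_measure (c := 2⁻¹) (by simp)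
  have j2 := hi'.smul_measure (c := 2⁻¹) (by simp)
  refine ⟨j1.add_measure j2, ?_⟩
  rw [symmetrize, integral_add_measure j1 j2, integral_smul_measure, integral_smul_measure, he]
  simp
  ring

lemma tail_symmetrize (ρ : Measure ℝ) [IsFiniteMeasure ρ] (t : ℝ) :
    tail (symmetrize ρ) t = tail ρ t := by
  have hm : MeasurableSet {x : ℝ | t ≤ |x|} := measurableSet_le measurable_const measurable_norm
  have h : (ρ.map fun x => -x) {x : ℝ | t ≤ |x|} = ρ {x : ℝ | t ≤ |x|} := by
    rw [Measure.map_apply measurable_neg hm]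
    congr 1
    ext x
    simp
  rw [tail, tail, measureReal_def, measureReal_def, symmetrize, Measure.add_apply, Measure.smul_apply, Measure.smul_apply, h, smul_eq_mul,
    ← add_mul, ENNReal.inv_two_add_inv_two, one_mul]

/-- The law of `ε W(E)` for a standard exponential `E` and an independent random sign `ε`. -/
noncomputable def expLaw (W : ℝ → ℝ) : Measure ℝ := symmetrize (stdExp.map W)

section expLaw

variable {W : ℝ → ℝ}

lemma isSymmetricLaw_expLaw (hW : Measurable W) : IsSymmetricLaw (expLaw W) := by
  have : IsProbabilityMeasure (stdExp.map W) :=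
    Measure.isProbabilityMeasure_map hW.aemeasurable
  exact isSymmetricLaw_symmetrize _

lemma integral_expLaw (hW : Measurable W) {f : ℝ → ℝ} (hf : ∀ x, f (-x) = f x)
    (hfm : Measurable f) (hi : Integrable (fun x => f (W x)) stdExp) :
    Integrable f (expLaw W) ∧ ∫ x, f x ∂(expLaw W) = ∫ x, f (W x) ∂stdExp := by
  obtain ⟨h1, h2⟩ := integral_symmetrize (ρ := stdExp.map W) hf
    ((integrable_map_measure hfm.aestronglyMeasurable hW.aemeasurable).2 hi)
  exact ⟨h1, h2.trans (integral_map hW.aemeasurable hfm.aestronglyMeasurable)⟩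

lemma tail_expLaw (hW : Measurable W) (t : ℝ) :
    tail (expLaw W) t = stdExp.real {x | t ≤ |W x|} := by
  have : IsProbabilityMeasure (stdExp.map W) :=
    Measure.isProbabilityMeasure_map hW.aemeasurable
  rw [expLaw, tail_symmetrize, tail,
    map_measureReal_apply hW (s := {x | t ≤ |x|})
      (measurableSet_le measurable_const measurable_norm)]
  rfl

lemma tail_expLaw_eq_exp (hW : Measurable W) (hpos : ∀ x, 0 < x → 0 ≤ W x) {t u : ℝ}
    (hu : 0 ≤ u) (h : ∀ x, 0 < x → (t ≤ W x ↔ u ≤ x)) :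
    tail (expLaw W) t = Real.exp (-u) := by
  rw [tail_expLaw hW, ← ENNReal.toReal_ofReal (Real.exp_pos (-u)).le, ← stdExp_Ici hu,
    measureReal_def]
  congr 1
  refine measure_congr ?_
  filter_upwards [ae_stdExp_pos] with x hx
  refine eq_iff_iff.2 ?_
  change t ≤ |W x| ↔ u ≤ x
  rw [abs_of_nonneg (hpos x hx), h x hx]

lemma tail_expLaw_eq_zero (hW : Measurable W) (hpos : ∀ x, 0 < x → 0 ≤ W x) {t : ℝ}
    (h : ∀ x, 0 < x → W x < t) : tail (expLaw W) t = 0 := by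
  rw [tail_expLaw hW, measureReal_def, ENNReal.toReal_eq_zero_iff]
  left
  have : ∀ᵐ x ∂stdExp, ¬ t ≤ |W x| := by
    filter_upwards [ae_stdExp_pos] with x hx
    rw [abs_of_nonneg (hpos x hx)]
    exact not_le.2 (h x hx)
  simpa [ae_iff] using this

end expLaw

/-! ### Existence in the extremal classes -/

/-- A family of positive functions of a standard exponential variable, interpolating between the
constant `1` at `θ = 0` and the identity at `θ = 1`. -/
structure IsInterpolation (Z : ℝ → ℝ → ℝ) : Prop where
  measurable : ∀ θ, Measurable (Z θ)
  pos : ∀ θ ∈ Icc (0 : ℝ) 1, ∀ x, 0 < x → 0 < Z θ x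
  le : ∀ θ ∈ Icc (0 : ℝ) 1, ∀ x, 0 < x → Z θ x ≤ 1 + x
  continuousOn : ∀ x, 0 < x → ContinuousOn (fun θ => Z θ x) (Icc 0 1)
  at_zero : ∀ x, 0 < x → Z 0 x = 1
  at_one : ∀ x, 0 < x → Z 1 x = x

namespace IsInterpolation

variable {Z : ℝ → ℝ → ℝ}

lemma integrable_rpow (hZ : IsInterpolation Z) {q : ℝ} (hq : 0 < q) {θ : ℝ}
    (hθ : θ ∈ Icc (0 : ℝ) 1) :
    Integrable (fun x => Z θ x ^ q) stdExp := by
  refine (integrable_one_add_rpow_stdExp hq).mono'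
    ((hZ.measurable θ).pow_const q).aestronglyMeasurable ?_
  filter_upwards [ae_stdExp_pos] with x hx
  rw [Real.norm_of_nonneg (Real.rpow_nonneg (hZ.pos θ hθ x hx).le _)]
  exact Real.rpow_le_rpow (hZ.pos θ hθ x hx).le (hZ.le θ hθ x hx) hq.le

lemma continuousOn_integral_rpow (hZ : IsInterpolation Z) {q : ℝ} (hq : 0 < q) :
    ContinuousOn (fun θ => ∫ x, Z θ x ^ q ∂stdExp) (Icc 0 1) := by
  refine continuousOn_of_dominated (bound := fun x => (1 + x) ^ q)
    (fun θ _ => ((hZ.measurable θ).pow_const q).aestronglyMeasurable) (fun θ hθ => ?_)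
    (integrable_one_add_rpow_stdExp hq) ?_
  · filter_upwards [ae_stdExp_pos] with x hx
    rw [Real.norm_of_nonneg (Real.rpow_nonneg (hZ.pos θ hθ x hx).le _)]
    exact Real.rpow_le_rpow (hZ.pos θ hθ x hx).le (hZ.le θ hθ x hx) hq.le
  · filter_upwards [ae_stdExp_pos] with x hx
    exact (hZ.continuousOn x hx).rpow_const fun θ hθ => Or.inr hq.le

lemma integral_rpow_pos (hZ : IsInterpolation Z) {q : ℝ} (hq : 0 < q) {θ : ℝ}
    (hθ : θ ∈ Icc (0 : ℝ) 1) :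
    0 < ∫ x, Z θ x ^ q ∂stdExp := by
  have hpos : ∀ᵐ x ∂stdExp, 0 < Z θ x ^ q := by
    filter_upwards [ae_stdExp_pos] with x hx
    exact Real.rpow_pos_of_pos (hZ.pos θ hθ x hx) q
  rw [integral_pos_iff_support_of_nonneg_ae (hpos.mono fun x hx => hx.le)
    (hZ.integrable_rpow hq hθ)]
  have : stdExp (Function.support fun x => Z θ x ^ q) = 1 := by
    rw [prob_compl_eq_zero_iff₀ ?_ |>.symm]
    · exact measure_eq_zero_iff_ae_notMem.2 (hpos.mono fun x hx h => h hx.ne')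
    · exact ((hZ.measurable θ).pow_const q).nullMeasurable
        (measurableSet_singleton (0 : ℝ)).compl
  rw [this]
  exact one_pos

/-- Every feasible pair of moments is realized within a rescaled interpolating family. -/
lemma exists_hasMoments (hZ : IsInterpolation Z) {p a b : ℝ} (hp : 2 < p) (ha : 0 < a)
    (hb : 0 < b) (hfeas : Feasible p a b) :
    ∃ θ ∈ Icc (0 : ℝ) 1, ∃ s, 0 < s ∧ HasMoments p a b (expLaw fun x => s * Z θ x) := by
  obtain ⟨μ, hμ, hlc, mμ⟩ := hfeas
  have := hμ.isProbabilityMeasure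
  have hp0 : 0 < p := by linarith
  set M : ℝ → ℝ := fun θ => ∫ x, Z θ x ^ (2 : ℝ) ∂stdExp with hM
  set N : ℝ → ℝ := fun θ => ∫ x, Z θ x ^ p ∂stdExp with hN
  have hMpos : ∀ θ ∈ Icc (0 : ℝ) 1, 0 < M θ := fun θ hθ => hZ.integral_rpow_pos two_pos hθ
  -- The scale that gives second moment `a ^ 2` for every `θ`, leaving the `p`-th moment to be
  -- adjusted through `θ`.
  set σ : ℝ → ℝ := fun θ => a / √(M θ) with hσ
  have hσpos : ∀ θ ∈ Icc (0 : ℝ) 1, 0 < σ θ := fun θ hθ =>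
    div_pos ha (Real.sqrt_pos.2 (hMpos θ hθ))
  have hWm : ∀ θ, Measurable fun x => σ θ * Z θ x := fun θ => (hZ.measurable θ).const_mul _
  have hWpos : ∀ θ ∈ Icc (0 : ℝ) 1, ∀ x, 0 < x → 0 ≤ σ θ * Z θ x := fun θ hθ x hx =>
    (mul_pos (hσpos θ hθ) (hZ.pos θ hθ x hx)).le
  have hsq : ∀ θ ∈ Icc (0 : ℝ) 1,
      Integrable (fun x : ℝ => x ^ 2) (expLaw fun x => σ θ * Z θ x) ∧
      ∫ x, x ^ 2 ∂(expLaw fun x => σ θ * Z θ x) = a ^ 2 := by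
    intro θ hθ
    have e : (fun x => (σ θ * Z θ x) ^ 2) = fun x => σ θ ^ 2 * Z θ x ^ (2 : ℝ) := by
      ext x; rw [Real.rpow_two, mul_pow]
    obtain ⟨h1, h2⟩ := integral_expLaw (hWm θ) (f := fun x => x ^ 2) (fun x => neg_sq x)
      (by fun_prop) (by rw [e]; exact (hZ.integrable_rpow two_pos hθ).const_mul _)
    refine ⟨h1, h2.trans ?_⟩
    rw [e, integral_const_mul]
    change (a / √(M θ)) ^ 2 * M θ = a ^ 2
    rw [div_pow, Real.sq_sqrt (hMpos θ hθ).le, div_mul_cancel₀ _ (hMpos θ hθ).ne']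
  have hpth : ∀ θ ∈ Icc (0 : ℝ) 1,
      Integrable (fun x : ℝ => |x| ^ p) (expLaw fun x => σ θ * Z θ x) ∧
      ∫ x, |x| ^ p ∂(expLaw fun x => σ θ * Z θ x) = σ θ ^ p * N θ := by
    intro θ hθ
    have e : (fun x => |σ θ * Z θ x| ^ p) =ᵐ[stdExp] fun x => σ θ ^ p * Z θ x ^ p := by
      filter_upwards [ae_stdExp_pos] with x hx
      rw [abs_of_nonneg (hWpos θ hθ x hx),
        Real.mul_rpow (hσpos θ hθ).le (hZ.pos θ hθ x hx).le]
    obtain ⟨h1, h2⟩ := integral_expLaw (hWm θ) (f := fun x => |x| ^ p) (fun x => by rw [abs_neg])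
      (by fun_prop) (((hZ.integrable_rpow hp0 hθ).const_mul _).congr e.symm)
    refine ⟨h1, h2.trans ?_⟩
    rw [integral_congr_ae e, integral_const_mul]
  have hcont : ContinuousOn (fun θ => σ θ ^ p * N θ) (Icc 0 1) := by
    refine ContinuousOn.mul (ContinuousOn.rpow_const ?_ fun θ _ => Or.inr hp0.le)
      (hZ.continuousOn_integral_rpow hp0)
    exact continuousOn_const.div (hZ.continuousOn_integral_rpow two_pos).sqrt
      fun θ hθ => (Real.sqrt_pos.2 (hMpos θ hθ)).ne'
  have m0 : (0 : ℝ) ∈ Icc (0 : ℝ) 1 := ⟨le_rfl, zero_le_one⟩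
  have m1 : (1 : ℝ) ∈ Icc (0 : ℝ) 1 := ⟨zero_le_one, le_rfl⟩
  -- At `θ = 0` the law is that of a random sign times `σ 0`: its tail drops from `1` to `0`, so any
  -- other tail crosses it once.
  have hlow : σ 0 ^ p * N 0 ≤ b ^ p := by
    rw [← (hpth 0 m0).2, ← mμ.pth]
    refine (abs_rpow_moment_le hp hμ (isSymmetricLaw_expLaw (hWm 0)) (mμ.integrable_sq ha)
      (hsq 0 m0).1 (mμ.integrable_abs_rpow hb) (hpth 0 m0).1
      (mμ.second.trans (hsq 0 m0).2.symm) fun t u ht htu h => ?_).1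
    have hst : σ 0 < t := by
      by_contra! hc
      rw [tail_expLaw_eq_exp (hWm 0) (hWpos 0 m0) (u := 0) le_rfl fun x hx => by
        rw [hZ.at_zero x hx, mul_one]
        exact ⟨fun _ => hx.le, fun _ => hc⟩, neg_zero, Real.exp_zero] at h
      linarith [tail_le_one μ t]
    rw [tail_expLaw_eq_zero (hWm 0) (hWpos 0 m0) fun x hx => by
      rw [hZ.at_zero x hx, mul_one]; linarith]
    exact tail_nonneg _ _
  -- At `θ = 1` the law is two-sided exponential; once its tail exceeds a log-concave tail, it stays
  -- above.
  have hhigh : b ^ p ≤ σ 1 ^ p * N 1 := by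
    rw [← (hpth 1 m1).2, ← mμ.pth]
    have hJ : IsPlusTail (σ 1)⁻¹ univ (tail (expLaw fun x => σ 1 * Z 1 x)) := by
      refine ⟨mem_univ _, ordConnected_univ, fun t _ ht => ?_, fun t ht => absurd (mem_univ t) ht⟩
      refine tail_expLaw_eq_exp (hWm 1) (hWpos 1 m1)
        (mul_nonneg (inv_nonneg.2 (hσpos 1 m1).le) ht) fun x hx => ?_
      rw [hZ.at_one x hx, inv_mul_le_iff₀ (hσpos 1 m1)]
    exact (abs_rpow_moment_le hp (isSymmetricLaw_expLaw (hWm 1)) hμ (hsq 1 m1).1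
      (mμ.integrable_sq ha) (hpth 1 m1).1 (mμ.integrable_abs_rpow hb)
      ((hsq 1 m1).2.trans mμ.second.symm) fun t u ht htu h =>
        (hJ.tail_lt hlc ht htu h (mem_univ u)).le).1
  obtain ⟨θ, hθ, h⟩ := intermediate_value_Icc zero_le_one hcont ⟨hlow, hhigh⟩
  exact ⟨θ, hθ, σ θ, hσpos θ hθ, (hsq θ hθ).2, (hpth θ hθ).2.trans h⟩

end IsInterpolation

/-- After scaling by `s` this is a shifted exponential variable, with `β = s (1 - θ)` and `α = 1 /
(s θ)`; `θ = 0` corresponds to `α = ∞`. -/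
lemma isInterpolation_affine : IsInterpolation fun θ x => (1 - θ) + θ * x where
  measurable θ := by fun_prop
  pos θ hθ x hx := by
    rcases hθ.1.eq_or_lt with rfl | h
    · simp
    · have := mul_pos h hx
      linarith [hθ.2]
  le θ hθ x hx := by
    have := mul_le_mul_of_nonneg_right hθ.2 hx.le
    linarith [hθ.1]
  continuousOn x hx := by fun_prop
  at_zero x hx := by simp
  at_one x hx := by simp

lemma max_mul_pos {θ x : ℝ} (hθ : θ ∈ Icc (0 : ℝ) 1) (hx : 0 < x) : 0 < max θ ((1 - θ) * x) := by
  rcases hθ.1.eq_or_lt with rfl | h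
  · exact lt_max_of_lt_right (by simpa using hx)
  · exact lt_max_of_lt_left h

/-- For `0 < θ < 1` this is `min (x / θ) (1 / (1 - θ))`, in a form that remains valid at both ends.
After scaling by `s` it gives `α = θ / s` and `β = s / (1 - θ)`; `θ = 1` corresponds to `β = ∞`. -/
lemma isInterpolation_truncated : IsInterpolation fun θ x => x / max θ ((1 - θ) * x) where
  measurable θ := by fun_prop
  pos θ hθ x hx := div_pos hx (max_mul_pos hθ hx)
  le θ hθ x hx := by
    rw [div_le_iff₀ (max_mul_pos hθ hx)]
    have h1 := le_max_left θ ((1 - θ) * x)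
    have h2 := le_max_right θ ((1 - θ) * x)
    have h3 := mul_le_mul_of_nonneg_left h1 hx.le
    linarith
  continuousOn x hx := ContinuousOn.div (by fun_prop) (by fun_prop)
    fun θ hθ => (max_mul_pos hθ hx).ne'
  at_zero x hx := by simp [max_eq_right hx.le, hx.ne']
  at_one x hx := by simp

lemma exists_mem_gMinus {p a b : ℝ} (hp : 2 < p) (ha : 0 < a) (hb : 0 < b)
    (hfeas : Feasible p a b) : ∃ μ ∈ GMinus, HasMoments p a b μ := by
  obtain ⟨θ, hθ, s, hs, hm⟩ := isInterpolation_affine.exists_hasMoments hp ha hb hfeas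
  have hWm : Measurable fun x : ℝ => s * ((1 - θ) + θ * x) := by fun_prop
  have hWpos : ∀ x : ℝ, 0 < x → 0 ≤ s * ((1 - θ) + θ * x) := fun x hx =>
    (mul_pos hs (isInterpolation_affine.pos θ hθ x hx)).le
  refine ⟨_, ⟨isSymmetricLaw_expLaw hWm, ?_⟩, hm⟩
  rcases hθ.1.eq_or_lt with rfl | h
  · refine Or.inr ⟨s, hs.le, fun t ht => ?_⟩
    by_cases hts : t ≤ s
    · rw [indicator_of_mem (show t ∈ Icc 0 s from ⟨ht, hts⟩),
        tail_expLaw_eq_exp hWm hWpos (u := 0) le_rfl fun x hx => by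
          simp [hts, hx.le], neg_zero, Real.exp_zero]
    · rw [indicator_of_notMem fun h => hts h.2]
      exact tail_expLaw_eq_zero hWm hWpos fun x hx => by simpa using hts
  · refine Or.inl ⟨(s * θ)⁻¹, s * (1 - θ), by positivity,
      mul_nonneg hs.le (by linarith [hθ.2]), fun t ht => ?_⟩
    have hsθ : 0 < s * θ := mul_pos hs h
    refine tail_expLaw_eq_exp hWm hWpos (by positivity) fun x hx => ?_
    rw [inv_mul_le_iff₀ hsθ, max_le_iff]
    have h0 : 0 ≤ s * θ * x := by positivity
    constructor
    · intro h; exact ⟨by linarith, h0⟩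
    · intro h; linarith [h.1]

lemma exists_mem_gPlus {p a b : ℝ} (hp : 2 < p) (ha : 0 < a) (hb : 0 < b)
    (hfeas : Feasible p a b) : ∃ μ ∈ GPlus, HasMoments p a b μ := by
  obtain ⟨θ, hθ, s, hs, hm⟩ := isInterpolation_truncated.exists_hasMoments hp ha hb hfeas
  have hWm : Measurable fun x : ℝ => s * (x / max θ ((1 - θ) * x)) := by fun_prop
  have hWpos : ∀ x : ℝ, 0 < x → 0 ≤ s * (x / max θ ((1 - θ) * x)) := fun x hx =>
    (mul_pos hs (isInterpolation_truncated.pos θ hθ x hx)).le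
  have hiff : ∀ t x : ℝ, 0 ≤ t → 0 < x →
      (t ≤ s * (x / max θ ((1 - θ) * x)) ↔ θ / s * t ≤ x ∧ t * (1 - θ) ≤ s) := by
    intro t x ht hx
    rw [← mul_div_assoc, le_div_iff₀ (max_mul_pos hθ hx), mul_max_of_nonneg _ _ ht, max_le_iff,
      ← mul_assoc, mul_le_mul_iff_left₀ hx, div_mul_eq_mul_div, div_le_iff₀ hs, mul_comm t θ,
      mul_comm s x]
  refine ⟨_, ⟨isSymmetricLaw_expLaw hWm, ?_⟩, hm⟩
  have hα : 0 ≤ θ / s := div_nonneg hθ.1 hs.le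
  rcases hθ.2.eq_or_lt with h | h
  · refine Or.inr ⟨θ / s, hα, fun t ht => ?_⟩
    refine tail_expLaw_eq_exp hWm hWpos (mul_nonneg hα ht) fun x hx => ?_
    rw [hiff t x ht hx]
    simp [h, hs.le]
  · have h1 : 0 < 1 - θ := by linarith
    refine Or.inl ⟨θ / s, s / (1 - θ), hα, by positivity, fun t ht => ?_⟩
    by_cases hts : t ≤ s / (1 - θ)
    · rw [indicator_of_mem (show t ∈ Icc 0 (s / (1 - θ)) from ⟨ht, hts⟩)]
      refine tail_expLaw_eq_exp hWm hWpos (mul_nonneg hα ht) fun x hx => ?_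
      rw [hiff t x ht hx, ← le_div_iff₀ h1]
      simp [hts]
    · rw [indicator_of_notMem fun h => hts h.2]
      refine tail_expLaw_eq_zero hWm hWpos fun x hx => ?_
      by_contra! hc
      exact hts ((le_div_iff₀ h1).2 ((hiff t x ht hx).1 hc).2)

/-! ### Sums of independent variables -/

/-- Fubini for the first coordinate, which is absorbed into the shift; the free `y` is what makes
the induction on `n` possible. -/
lemma lintegral_pi_succ {n : ℕ} (μ : Fin (n + 1) → Measure ℝ) [∀ j, IsProbabilityMeasure (μ j)]
    {F : ℝ → ENNReal} (hF : Measurable F) (y : ℝ) :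
    ∫⁻ x, F (∑ j, x j + y) ∂(Measure.pi μ) =
      ∫⁻ x₀, ∫⁻ x, F (∑ j, x j + (x₀ + y)) ∂(Measure.pi fun j : Fin n => μ j.succ) ∂(μ 0) := by
  have hm : Measurable fun z : ℝ × (Fin n → ℝ) => F (∑ j, z.2 j + (z.1 + y)) :=
    hF.comp (by fun_prop)
  have h := (measurePreserving_piFinSuccAbove μ 0).lintegral_comp hm
  have h2 := lintegral_prod (μ := μ 0) (ν := Measure.pi fun j : Fin n => μ j.succ) _ hm.aemeasurable
  simp only [Fin.zero_succAbove] at h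
  rw [← h2, ← h]
  refine lintegral_congr fun x => ?_
  congr 1
  rw [Fin.sum_univ_succ]
  simp [Fin.tail]
  ring

/-- Coordinatewise domination of all shifted integrals passes to sums. -/
lemma lintegral_pi_mono {n : ℕ} {μ ν : Fin n → Measure ℝ} [∀ j, IsProbabilityMeasure (μ j)]
    [∀ j, IsProbabilityMeasure (ν j)] {F : ℝ → ENNReal} (hF : Measurable F)
    (h : ∀ j y, ∫⁻ x, F (x + y) ∂(ν j) ≤ ∫⁻ x, F (x + y) ∂(μ j)) (y : ℝ) :
    ∫⁻ x, F (∑ j, x j + y) ∂(Measure.pi ν) ≤ ∫⁻ x, F (∑ j, x j + y) ∂(Measure.pi μ) := by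
  induction n generalizing y with
  | zero => simp
  | succ n ih =>
    rw [lintegral_pi_succ ν hF, lintegral_pi_succ μ hF]
    -- The later coordinates are exchanged first, with shift `x₀ + y`. After swapping the integrals,
    -- coordinate `0` is exchanged with the remaining sum plus `y` as shift.
    refine (lintegral_mono fun x₀ => ih (μ := fun j : Fin n => μ j.succ) (ν := fun j : Fin n => ν j.succ)
      (fun j => h j.succ) (x₀ + y)).trans ?_
    have hm : Measurable (Function.uncurry fun (x₀ : ℝ) (x : Fin n → ℝ) =>
      F (∑ j, x j + (x₀ + y))) := hF.comp (by fun_prop)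
    rw [lintegral_lintegral_swap hm.aemeasurable, lintegral_lintegral_swap hm.aemeasurable]
    refine lintegral_mono fun x => ?_
    have := h 0 (∑ j, x j + y)
    simpa only [add_left_comm] using this

lemma integrable_abs_sum_rpow {n : ℕ} {p : ℝ} (hp : 0 < p) {μ : Fin n → Measure ℝ}
    [∀ j, IsProbabilityMeasure (μ j)] (hi : ∀ j, Integrable (fun x : ℝ => |x| ^ p) (μ j)) :
    Integrable (fun x : Fin n → ℝ => |∑ j, x j| ^ p) (Measure.pi μ) := by
  rw [memLp_of_integrable_abs_rpow hp (by fun_prop)]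
  refine memLp_finsetSum _ fun j _ => ?_
  have h := (memLp_of_integrable_abs_rpow hp (by fun_prop)).1 (hi j)
  exact h.comp_measurePreserving (measurePreserving_eval μ j)

lemma integral_pi_abs_sum_mono {n : ℕ} {p : ℝ} (hp : 0 < p) {μ ν : Fin n → Measure ℝ}
    [∀ j, IsProbabilityMeasure (μ j)] [∀ j, IsProbabilityMeasure (ν j)]
    (iμ : ∀ j, Integrable (fun x : ℝ => |x| ^ p) (μ j))
    (iν : ∀ j, Integrable (fun x : ℝ => |x| ^ p) (ν j))
    (h : ∀ j y, ∫ x, |x + y| ^ p ∂(ν j) ≤ ∫ x, |x + y| ^ p ∂(μ j)) :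
    ∫ x, |∑ j, x j| ^ p ∂(Measure.pi ν) ≤ ∫ x, |∑ j, x j| ^ p ∂(Measure.pi μ) := by
  have key := lintegral_pi_mono (μ := μ) (ν := ν) (F := fun x => ENNReal.ofReal (|x| ^ p))
    (by fun_prop) (fun j y => ?_) 0
  · simp only [add_zero] at key
    have e : ∀ ρ : Fin n → Measure ℝ, (∀ j, IsProbabilityMeasure (ρ j)) →
        (∀ j, Integrable (fun x : ℝ => |x| ^ p) (ρ j)) →
        ∫⁻ x, ENNReal.ofReal (|∑ j, x j| ^ p) ∂(Measure.pi ρ) =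
          ENNReal.ofReal (∫ x, |∑ j, x j| ^ p ∂(Measure.pi ρ)) := fun ρ _ hρ =>
      (ofReal_integral_eq_lintegral_ofReal (integrable_abs_sum_rpow hp hρ)
        (Filter.Eventually.of_forall fun x => by positivity)).symm
    rw [e μ inferInstance iμ, e ν inferInstance iν] at key
    exact (ENNReal.ofReal_le_ofReal_iff (integral_nonneg fun x => by positivity)).1 key
  · rw [← ofReal_integral_eq_lintegral_ofReal (integrable_abs_add_rpow hp (iν j) y)
      (Filter.Eventually.of_forall fun x => by positivity),
      ← ofReal_integral_eq_lintegral_ofReal (integrable_abs_add_rpow hp (iμ j) y)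
      (Filter.Eventually.of_forall fun x => by positivity)]
    exact ENNReal.ofReal_le_ofReal (h j y)

lemma Admissible.integral_eq_pi {n : ℕ} {p : ℝ} {a b : Fin n → ℝ} {Ω : Type*}
    [MeasurableSpace Ω] {P : Measure Ω} [IsProbabilityMeasure P] {X : Fin n → Ω → ℝ}
    (h : Admissible p a b P X) :
    ∫ ω, |∑ j, X j ω| ^ p ∂P = ∫ x, |∑ j, x j| ^ p ∂(Measure.pi fun j => P.map (X j)) := by
  rw [← (iIndepFun_iff_map_fun_eq_pi_map fun j => (h.measurable j).aemeasurable).1 h.indep,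
    integral_map (measurable_pi_lambda _ h.measurable).aemeasurable]
  have hm : Measurable fun x : Fin n → ℝ => |∑ j, x j| ^ p := by fun_prop
  exact hm.aestronglyMeasurable

/-- The value for independent variables with given laws is attained on a probability space in an
arbitrary universe. -/
lemma pi_mem_sumMoments {n : ℕ} {p : ℝ} {a b : Fin n → ℝ} {μ : Fin n → Measure ℝ}
    (hμ : ∀ j, IsSymmetricLaw (μ j)) (hl : ∀ j, HasLogConcaveTail (μ j))
    (hm : ∀ j, HasMoments p (a j) (b j) (μ j)) :
    ∫ x, |∑ j, x j| ^ p ∂(Measure.pi μ) ∈ sumMoments.{u} p a b := by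
  have := fun j => (hμ j).isProbabilityMeasure
  let e : (Fin n → ℝ) ≃ᵐ ULift.{u} (Fin n → ℝ) := MeasurableEquiv.ulift.symm
  have he : MeasurePreserving e (Measure.pi μ) ((Measure.pi μ).map e) :=
    e.measurable.measurePreserving _
  let X : Fin n → ULift.{u} (Fin n → ℝ) → ℝ := fun j ω => ω.down j
  have hX : ∀ j, Measurable (X j) := fun j =>
    (measurable_pi_apply j).comp MeasurableEquiv.ulift.measurable
  have hP : IsProbabilityMeasure ((Measure.pi μ).map e) :=
    Measure.isProbabilityMeasure_map e.measurable.aemeasurable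
  have hlaw : ∀ j, ((Measure.pi μ).map e).map (X j) = μ j := fun j => by
    rw [Measure.map_map (hX j) e.measurable]
    exact (measurePreserving_eval μ j).map_eq
  refine ⟨ULift.{u} (Fin n → ℝ), inferInstance, (Measure.pi μ).map e, X, hP,
    ⟨hX, ?_, fun j => (hlaw j).symm ▸ hμ j, fun j => (hlaw j).symm ▸ hl j,
      fun j => (hlaw j).symm ▸ hm j⟩, ?_⟩
  · rw [iIndepFun_iff_map_fun_eq_pi_map fun j => (hX j).aemeasurable]
    simp_rw [hlaw]
    rw [Measure.map_map (measurable_pi_lambda _ hX) e.measurable]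
    exact Measure.map_id
  · exact (integral_map_equiv e fun ω => |∑ j, X j ω| ^ p).symm

end LogTail

/-- The expectation of `|∑ 𝐗_j| ^ p` for independent `𝐗_j` with laws `μ j` is the integral over
the product measure `Measure.pi μ`. -/
theorem theorem7 (p : ℝ) (hp : 4 < p) (n : ℕ) (hn : 1 ≤ n) (a b : Fin n → ℝ)
    (ha : ∀ j, 0 < a j) (hb : ∀ j, 0 < b j)
    (hfeas : ∀ j, LogTail.Feasible p (a j) (b j)) :
    (∀ j, ∃! μ : Measure ℝ, μ ∈ LogTail.GMinus ∧ LogTail.HasMoments p (a j) (b j) μ) ∧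
    (∀ j, ∃! μ : Measure ℝ, μ ∈ LogTail.GPlus ∧ LogTail.HasMoments p (a j) (b j) μ) ∧
    (∀ μ : Fin n → Measure ℝ,
      (∀ j, μ j ∈ LogTail.GMinus ∧ LogTail.HasMoments p (a j) (b j) (μ j)) →
      IsLeast (LogTail.sumMoments.{u} p a b) (∫ x, |∑ j, x j| ^ p ∂(Measure.pi μ))) ∧
    (∀ μ : Fin n → Measure ℝ,
      (∀ j, μ j ∈ LogTail.GPlus ∧ LogTail.HasMoments p (a j) (b j) (μ j)) →
      IsGreatest (LogTail.sumMoments.{u} p a b) (∫ x, |∑ j, x j| ^ p ∂(Measure.pi μ))) := by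
  have hp2 : 2 < p := by linarith
  have hp0 : 0 < p := by linarith
  refine ⟨fun j => ?_, fun j => ?_, fun μ hμ => ⟨?_, ?_⟩, fun μ hμ => ⟨?_, ?_⟩⟩
  · obtain ⟨μ, hμ, mμ⟩ := LogTail.exists_mem_gMinus hp2 (ha j) (hb j) (hfeas j)
    exact ⟨μ, ⟨hμ, mμ⟩, fun ν hν => LogTail.gMinus_unique hp2 (ha j) (hb j) hν.1 hμ hν.2 mμ⟩
  · obtain ⟨μ, hμ, mμ⟩ := LogTail.exists_mem_gPlus hp2 (ha j) (hb j) (hfeas j)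
    exact ⟨μ, ⟨hμ, mμ⟩, fun ν hν => LogTail.gPlus_unique hp2 (ha j) (hb j) hν.1 hμ hν.2 mμ⟩
  · exact LogTail.pi_mem_sumMoments (fun j => (hμ j).1.1)
      (fun j => LogTail.hasLogConcaveTail_of_mem_gMinus (hμ j).1) fun j => (hμ j).2
  · rintro v ⟨Ω, _, P, X, _, hX, rfl⟩
    have := fun j => (hμ j).1.1.isProbabilityMeasure
    have := fun j => (hX.symmetric j).isProbabilityMeasure
    rw [hX.integral_eq_pi]
    exact LogTail.integral_pi_abs_sum_mono hp0
      (fun j => (hX.moments j).integrable_abs_rpow (hb j))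
      (fun j => (hμ j).2.integrable_abs_rpow (hb j))
      fun j => LogTail.integral_shift_le hp (ha j) (hb j) (hX.symmetric j) (hμ j).1.1
        (hX.moments j) (hμ j).2
        (LogTail.ordConnected_tail_sub_gMinus (hX.logConcaveTail j) (hμ j).1)
  · exact LogTail.pi_mem_sumMoments (fun j => (hμ j).1.1)
      (fun j => LogTail.hasLogConcaveTail_of_mem_gPlus (hμ j).1) fun j => (hμ j).2
  · rintro v ⟨Ω, _, P, X, _, hX, rfl⟩
    have := fun j => (hμ j).1.1.isProbabilityMeasure
    have := fun j => (hX.symmetric j).isProbabilityMeasure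
    rw [hX.integral_eq_pi]
    -- The roles are reversed: now the extremal tail exceeds the admissible one on an interval.
    exact LogTail.integral_pi_abs_sum_mono hp0
      (fun j => (hμ j).2.integrable_abs_rpow (hb j))
      (fun j => (hX.moments j).integrable_abs_rpow (hb j))
      fun j => LogTail.integral_shift_le hp (ha j) (hb j) (hμ j).1.1 (hX.symmetric j)
        (hμ j).2 (hX.moments j)
        (LogTail.ordConnected_gPlus_sub_tail (hX.logConcaveTail j) (hμ j).1)
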